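/- Let $p\ge 1$, $n\ge 2$, let $\mathcal C\subset\mathbb R^p$ be a closed bounded convex set with nonempty interior, let $\mathcal X$ be a set, and let $\ell(\cdot;d)$, $d\in\mathcal X$, be losses that are $L$-Lipschitz and $\Delta$-strongly convex on $\mathcal C$ ($L,\Delta>0$). For $\mathcal D=(d_1,\dots,d_n)\in\mathcal X^n$ put $\mathcal L(\theta;\mathcal D)=\sum_{i=1}^n\ell(\theta;d_i)$ and $\theta^*=\arg\min_{\theta\in\mathcal C}\mathcal L(\theta;\mathcal D)$. Write $\|S\|_2$ for the diameter of a set $S$ and $\Pi_{\mathcal C}$ for the Euclidean projection onto $\mathcal C$. A randomized algorithm $\mathcal A$ is $\epsilon$-differentially private if $\Pr[\mathcal A(\mathcal D)\in S]\le e^{\epsilon}\Pr[\mathcal A(\mathcal D')\in S]$ for all measurable $S$ and all $\mathcal D,\mathcal D'\in\mathcal X^n$ that differ in one entry. Given $\epsilon>0$ and an algorithm $\mathcal A_{\rm gen}$ that takes a loss, its Lipschitz constant, a privacy parameter, a convex set and a data set, the *localization algorithm* with subroutine $\mathcal A_{\rm gen}$ works in two steps. 1. Sample $b\in\mathbb R^p$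 with density proportional to $e^{-\frac{n\Delta\epsilon}{4L}\|b\|_2}$, put $\theta_0=\Pi_{\mathcal C}(\theta^*+b)$ and $$\mathcal C_0=\Big\{\theta\in\mathcal C:\ \|\theta-\theta_0\|_2\le \tfrac{12Lp\log n}{\Delta\epsilon n}\Big\}.$$ 2. Run $\mathcal A_{\rm gen}$ on $\ell$, $L$, $\epsilon/2$, $\mathcal C_0$, $\mathcal D$ and output its output $\theta^{priv}$. *Exponential sampling* with privacy parameter $\epsilon'$ on a set $\tilde{\mathcal C}$ outputs a point of $\tilde{\mathcal C}$ with density proportional to $\exp\big(-\frac{\epsilon'}{2L\|\tilde{\mathcal C}\|_2}\mathcal L(\theta;\mathcal D)\big)$. Below, $\tilde{\mathcal C}$ ranges over the compact convex sets with nonempty interior contained in $\mathcal C$, and it is assumed that the law of the output of $\mathcal A_{\rm gen}$ in step 2 depends measurably on $\theta_0\in\mathcal C$. For every $B>0$ there is a constant $K$, depending only on $B$, such that the following holds for all such $p,n,\mathcal X,\ell,\mathcal C,L,\Delta$ and $\epsilon$. (a) The norm $\|b\|_2$ has the Gamma distribution with shape $p$ and scale $\frac{4L}{n\Delta\epsilon}$.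 (b) (Exponential sampling.) The localization algorithm with exponential sampling as subroutine outputs a point of $\mathcal C$ and is $\epsilon$-differentially private. If $\epsilon\le B\,p\,n^2$, then for every $\mathcal D$ $$\mathbb E\big[\mathcal L(\theta^{priv};\mathcal D)-\mathcal L(\theta^*;\mathcal D)\big]\le K\,\frac{p^2L^2}{n\Delta\epsilon^2}\log n .$$ (c) (Approximate exponential sampling.) Suppose that for all $\tilde{\mathcal C}$ and $\mathcal D$ the law $\hat\mu$ of the output of $\mathcal A_{\rm gen}$ with privacy parameter $\epsilon/2$ and the law $\mu$ of exponential sampling with privacy parameter $\epsilon/6$ on $\tilde{\mathcal C}$ satisfy $\sup|\log\frac{d\hat\mu}{d\mu}|\le\epsilon/6$. Then the localization algorithm with subroutine $\mathcal A_{\rm gen}$ outputs a point of $\mathcal C$ and is $\epsilon$-differentially private, and if $\epsilon\le B$, it satisfies the risk bound of (b). (d) (Generic privacy.) If, for the loss $\ell$ and every $\tilde{\mathcal C}$, the algorithm $\mathcal A_{\rm gen}$ with privacy parameter $\epsilon/2$ outputs a point of $\tilde{\mathcal C}$ and is $\epsilon/2$-differentially private, then the localization algorithm with subroutine $\mathcal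 A_{\rm gen}$ outputs a point of $\mathcal C$ and is $\epsilon$-differentially private. (e) (Generic utility.) Let $F(p,n,\epsilon/2,L,\cdot)$ be nondecreasing on $[0,\infty)$. Suppose that for every $\tilde{\mathcal C}$, every data universe and every loss that is convex and $L$-Lipschitz on $\tilde{\mathcal C}$, the algorithm $\mathcal A_{\rm gen}$ with privacy parameter $\epsilon/2$ outputs a point $\tilde\theta\in\tilde{\mathcal C}$, is $\epsilon/2$-differentially private, and has expected excess empirical risk over $\tilde{\mathcal C}$ at most $F(p,n,\epsilon/2,L,\|\tilde{\mathcal C}\|_2)$ on every data set. If $\epsilon\le B$, then the localization algorithm with subroutine $\mathcal A_{\rm gen}$ satisfies, for every $\mathcal D$, $$\mathbb E\big[\mathcal L(\theta^{priv};\mathcal D)-\mathcal L(\theta^*;\mathcal D)\big]\le K\,F\Big(p,n,\tfrac{\epsilon}{2},L,\tfrac{24Lp\log n}{\Delta\epsilon n}\Big).$$ -/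

import Mathlib

open MeasureTheory ProbabilityTheory

universe u

namespace PrivateERM

noncomputable section

/-- The empirical loss `𝓛(θ; D) = ∑ i, ℓ(θ; dᵢ)` of a data set `D = (d₁, …, dₙ)`. -/
def empLoss {p n : ℕ} {X : Type u} (ℓ : EuclideanSpace ℝ (Fin p) → X → ℝ) (D : Fin n → X)
    (θ : EuclideanSpace ℝ (Fin p)) : ℝ :=
  ∑ i, ℓ θ (D i)

/-- A minimizer of `f` over `C` (an arbitrary point if there is none). -/
def argminOn {p : ℕ} (C : Set (EuclideanSpace ℝ (Fin p))) (f : EuclideanSpace ℝ (Fin p) → ℝ) :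
    EuclideanSpace ℝ (Fin p) :=
  Classical.epsilon fun x => x ∈ C ∧ IsMinOn f C x

/-- The Euclidean projection onto `C`: the point of `C` nearest to `θ`. -/
def proj {p : ℕ} (C : Set (EuclideanSpace ℝ (Fin p))) (θ : EuclideanSpace ℝ (Fin p)) :
    EuclideanSpace ℝ (Fin p) :=
  argminOn C fun x => ‖θ - x‖

/-- A compact convex set with nonempty interior. -/
def IsBody {p : ℕ} (C : Set (EuclideanSpace ℝ (Fin p))) : Prop :=
  Convex ℝ C ∧ IsCompact C ∧ (interior C).Nonempty

/-- Every `ℓ(·; d)` is `L`-Lipschitz on `C` in the Euclidean norm. -/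
def IsLipschitzLoss {p : ℕ} {X : Type u} (ℓ : EuclideanSpace ℝ (Fin p) → X → ℝ) (L : ℝ)
    (C : Set (EuclideanSpace ℝ (Fin p))) : Prop :=
  ∀ d, ∀ x ∈ C, ∀ y ∈ C, |ℓ x d - ℓ y d| ≤ L * ‖x - y‖

/-- Two data sets of size `n` are neighbors if they differ in (at most) one entry. -/
def Neighbors {n : ℕ} {X : Type u} (D D' : Fin n → X) : Prop :=
  ∃ i, ∀ j, j ≠ i → D j = D' j

/-- `ε`-differential privacy of a randomized algorithm, given by its output laws `M D`. -/
def IsDP {n : ℕ} {X : Type u} {Θ : Type*} [MeasurableSpace Θ] (ε : ℝ)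
    (M : (Fin n → X) → Measure Θ) : Prop :=
  ∀ D D', Neighbors D D' → ∀ S, MeasurableSet S →
    M D S ≤ ENNReal.ofReal (Real.exp ε) * M D' S

/-- The multiplicative distance `sup |log (dμ/dν)|` of `μ` and `ν` is at most `t`. -/
def MulDistLE {Θ : Type*} [MeasurableSpace Θ] (t : ℝ) (μ ν : Measure Θ) : Prop :=
  ∀ S, MeasurableSet S →
    μ S ≤ ENNReal.ofReal (Real.exp t) * ν S ∧ ν S ≤ ENNReal.ofReal (Real.exp t) * μ S

/-- A (black-box) randomized algorithm for minimizing a Lipschitz loss. Its inputs are the data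
universe, the loss `ℓ`, the Lipschitz constant `L`, the privacy parameter `ε`, the constraint set
and the data set, in this order; its value is the law of the output. -/
abbrev LipAlgorithm (p n : ℕ) : Type (u + 1) :=
  (X : Type u) → (EuclideanSpace ℝ (Fin p) → X → ℝ) → ℝ → ℝ → Set (EuclideanSpace ℝ (Fin p)) →
    (Fin n → X) → Measure (EuclideanSpace ℝ (Fin p))

/-- Exponential sampling: the law on `C` with density proportional to
`exp (-(ε / (2 L ‖C‖₂)) 𝓛(θ; D))`, where `‖C‖₂` is the diameter of `C`. -/
def expSampling (p n : ℕ) : LipAlgorithm.{u} p n := fun _ ℓ L ε C D =>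
  (volume.restrict C).tilted fun θ => -(ε / (2 * L * Metric.diam C)) * empLoss ℓ D θ

/-- The law on `ℝᵖ` with density proportional to `exp (-rate * ‖b‖)`. -/
def noise (p : ℕ) (rate : ℝ) : Measure (EuclideanSpace ℝ (Fin p)) :=
  (volume : Measure (EuclideanSpace ℝ (Fin p))).tilted fun b => -rate * ‖b‖

/-- The law of the point `θ₀ = Π_C(θ* + b)` computed by output perturbation with privacy
parameter `ε`. -/
def perturbedMin {p n : ℕ} {X : Type u} (ℓ : EuclideanSpace ℝ (Fin p) → X → ℝ) (L Δ ε : ℝ)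
    (C : Set (EuclideanSpace ℝ (Fin p))) (D : Fin n → X) : Measure (EuclideanSpace ℝ (Fin p)) :=
  (noise p (n * Δ * ε / (2 * L))).map fun b => proj C (argminOn C (empLoss ℓ D) + b)

/-- The set `C₀` output by output perturbation with privacy parameter `ε` and radius parameter
`ζ`, as a function of `θ₀`. -/
def localSet {p : ℕ} (n : ℕ) (L Δ ε ζ : ℝ) (C : Set (EuclideanSpace ℝ (Fin p)))
    (θ₀ : EuclideanSpace ℝ (Fin p)) : Set (EuclideanSpace ℝ (Fin p)) :=
  {θ ∈ C | ‖θ - θ₀‖ ≤ ζ * (2 * L * p / (Δ * ε * n))}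

/-- The set `C₀` used by the localization algorithm with privacy parameter `ε`: output
perturbation is called with `ε / 2` and `ζ = 3 log n`. -/
def locSet {p : ℕ} (n : ℕ) (L Δ ε : ℝ) (C : Set (EuclideanSpace ℝ (Fin p)))
    (θ₀ : EuclideanSpace ℝ (Fin p)) : Set (EuclideanSpace ℝ (Fin p)) :=
  localSet n L Δ (ε / 2) (3 * Real.log n) C θ₀

/-- The localization algorithm for `Δ`-strongly convex losses with privacy parameter `ε`: output
perturbation with parameter `ε / 2`, followed by the algorithm `A` with parameter `ε / 2` on the
set `C₀` obtained in the first step. -/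
def localization {p n : ℕ} (A : LipAlgorithm.{u} p n) (Δ : ℝ) : LipAlgorithm.{u} p n :=
  fun X ℓ L ε C D =>
    (perturbedMin ℓ L Δ (ε / 2) C D).bind fun θ₀ => A X ℓ L (ε / 2) (locSet n L Δ ε C θ₀) D

/-- The second step of the localization algorithm is a measurable family of laws in the point
`θ₀ ∈ C` released in the first step, i.e. the two steps compose to a randomized algorithm. -/
def IsComposable {p n : ℕ} (A : LipAlgorithm.{u} p n) {X : Type u}
    (ℓ : EuclideanSpace ℝ (Fin p) → X → ℝ) (L Δ ε : ℝ) (C : Set (EuclideanSpace ℝ (Fin p))) :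
    Prop :=
  ∀ D : Fin n → X, Measurable fun θ₀ : C =>
    A X ℓ L (ε / 2) (locSet n L Δ ε C (θ₀ : EuclideanSpace ℝ (Fin p))) D

/-- Called on the loss `ℓ` and the set `C`, the algorithm `A` with privacy parameter `ε` outputs
a random point of `C`, and it is `ε`-differentially private. -/
def IsPrivateSolver {p n : ℕ} (A : LipAlgorithm.{u} p n) {X : Type u}
    (ℓ : EuclideanSpace ℝ (Fin p) → X → ℝ) (L ε : ℝ) (C : Set (EuclideanSpace ℝ (Fin p))) : Prop :=
  (∀ D, IsProbabilityMeasure (A X ℓ L ε C D) ∧ A X ℓ L ε C D Cᶜ = 0) ∧ IsDP ε (A X ℓ L ε C)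

/-- A random point with law `μ` has finite expected excess empirical risk over `C`, and the
latter is at most `R`. -/
def ExcessRiskLE {p n : ℕ} {X : Type u} (ℓ : EuclideanSpace ℝ (Fin p) → X → ℝ)
    (C : Set (EuclideanSpace ℝ (Fin p))) (D : Fin n → X) (μ : Measure (EuclideanSpace ℝ (Fin p)))
    (R : ℝ) : Prop :=
  Integrable (fun θ => empLoss ℓ D θ - empLoss ℓ D (argminOn C (empLoss ℓ D))) μ ∧
    ∫ θ, (empLoss ℓ D θ - empLoss ℓ D (argminOn C (empLoss ℓ D))) ∂μ ≤ R

end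

end PrivateERM

open PrivateERM

/-! Privacy is a composition of two `ε / 2` steps. Strong convexity makes the minimizer stable:
changing one entry moves it by at most `2L / (nΔ)`, so noise with density proportional to `exp
(-rate * ‖b‖)` and the matching rate hides the change, and projection is post-processing
(`isDP_perturbedMin`). Given `θ₀`, the second step is private on `C₀`, and `isDP_bind` adds the two
budgets.

For utility, let `r` be the radius of the ball defining `C₀`. If `‖b‖ ≤ r`, nonexpansiveness of the
projection puts the minimizer in `C₀`, and the second step pays only for a set of diameter at most
`2r`. Otherwise the excess loss is at most `n L` times a distance bounded by both `2‖b‖` and the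
diameter of `C`. The Gamma tail of `‖b‖` beyond `r` has first moment at most `2 r e / n ^ 3`, so
failure costs `2 e L min (2r) (diam C) / n ^ 2` (`excessRiskLE_localization`).

For exponential sampling, the expected excess under density `exp (-κ f)` is at most `2p / κ`,
without a logarithm (`lintegral_tilted_sub_le`); the only `log n` comes from `r`. The failure term
is absorbed through the bound on `ε`.

For a generic subroutine the failure term must be compared with the unknown bound `F`. Here the
assumption on all losses is used: privacy on linear losses `±L ⟨v, θ⟩` along a diameter forces `L *
diam ≤ (1 + exp (ε / 2)) * F` (`mul_diam_le_of_isPrivateSolver`). -/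

namespace PrivateERM

/-! ### Projections and minimizers over compact convex sets -/

section Minimizers

variable {p : ℕ} {C : Set (EuclideanSpace ℝ (Fin p))} {f : EuclideanSpace ℝ (Fin p) → ℝ}

theorem argminOn_spec (hC : IsCompact C) (hne : C.Nonempty) (hf : ContinuousOn f C) :
    argminOn C f ∈ C ∧ IsMinOn f C (argminOn C f) :=
  Classical.epsilon_spec (p := fun x => x ∈ C ∧ IsMinOn f C x) (hC.exists_isMinOn hne hf)

theorem proj_spec (hC : IsCompact C) (hne : C.Nonempty) (θ : EuclideanSpace ℝ (Fin p)) :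
    proj C θ ∈ C ∧ IsMinOn (fun x => ‖θ - x‖) C (proj C θ) :=
  argminOn_spec hC hne (by fun_prop)

theorem proj_mem (hC : IsCompact C) (hne : C.Nonempty) (θ : EuclideanSpace ℝ (Fin p)) :
    proj C θ ∈ C :=
  (proj_spec hC hne θ).1

theorem proj_of_mem (hC : IsCompact C) {θ : EuclideanSpace ℝ (Fin p)} (hθ : θ ∈ C) :
    proj C θ = θ := by
  have h := (proj_spec hC ⟨θ, hθ⟩ θ).2 hθ
  simp only [Set.mem_ofPred_eq, sub_self, norm_zero, norm_le_zero_iff, sub_eq_zero] at h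
  exact h.symm

theorem inner_proj_nonpos (hC : IsCompact C) (hconv : Convex ℝ C) (θ : EuclideanSpace ℝ (Fin p))
    {w : EuclideanSpace ℝ (Fin p)} (hw : w ∈ C) : inner ℝ (θ - proj C θ) (w - proj C θ) ≤ 0 := by
  obtain ⟨hmem, hmin⟩ := proj_spec hC ⟨w, hw⟩ θ
  refine (norm_eq_iInf_iff_real_inner_le_zero hconv hmem).1 ?_ w hw
  have : Nonempty C := ⟨⟨w, hw⟩⟩
  refine le_antisymm (le_ciInf fun x => hmin x.2) ?_
  exact ciInf_le ⟨0, by rintro _ ⟨x, rfl⟩; exact norm_nonneg _⟩ (⟨_, hmem⟩ : C)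

/-- Add the obtuse-angle inequalities at the two projections and apply Cauchy–Schwarz. -/
theorem norm_proj_sub_proj_le (hC : IsCompact C) (hconv : Convex ℝ C) (hne : C.Nonempty)
    (x y : EuclideanSpace ℝ (Fin p)) : ‖proj C x - proj C y‖ ≤ ‖x - y‖ := by
  have h1 := inner_proj_nonpos hC hconv x (proj_mem hC hne y)
  have h2 := inner_proj_nonpos hC hconv y (proj_mem hC hne x)
  set a := proj C x
  set b := proj C y
  have h3 : ‖a - b‖ * ‖a - b‖ ≤ ‖x - y‖ * ‖a - b‖ := by
    have h4 : inner ℝ (x - y) (a - b) =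
        inner ℝ (a - b) (a - b) - inner ℝ (x - a) (b - a) - inner ℝ (y - b) (a - b) := by
      simp only [inner_sub_left, inner_sub_right]
      ring
    have h5 := real_inner_le_norm (x - y) (a - b)
    rw [← real_inner_self_eq_norm_mul_norm]
    linarith
  rcases (norm_nonneg (a - b)).eq_or_lt with h | h
  · rw [← h]; positivity
  · exact le_of_mul_le_mul_right h3 h

theorem continuous_proj (hC : IsCompact C) (hconv : Convex ℝ C) (hne : C.Nonempty) :
    Continuous (proj C) := by
  have : LipschitzWith 1 (proj C) := LipschitzWith.of_dist_le_mul fun x y => by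
    simpa [dist_eq_norm] using norm_proj_sub_proj_le hC hconv hne x y
  exact this.continuous

/-- Quadratic growth at a minimizer: compare `f x` with `f` at `(1 - t) x + t y`, divide by `t`, and
let `t` tend to `0` from the right. -/
theorem strongConvexOn_sub_min_le {m : ℝ} (hf : StrongConvexOn C m f)
    {x y : EuclideanSpace ℝ (Fin p)} (hx : x ∈ C) (hmin : IsMinOn f C x) (hy : y ∈ C) :
    m / 2 * ‖x - y‖ ^ 2 ≤ f y - f x := by
  have key : ∀ t ∈ Set.Ioo (0 : ℝ) 1, (1 - t) * (m / 2 * ‖x - y‖ ^ 2) ≤ f y - f x := by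
    rintro t ⟨h0, h1⟩
    have h2 := hf.2 hx hy (sub_nonneg.2 h1.le) h0.le (by ring)
    have h3 : f x ≤ _ := hmin (hf.1 hx hy (sub_nonneg.2 h1.le) h0.le (by ring))
    simp only [smul_eq_mul] at h2
    have h4 : t * ((1 - t) * (m / 2 * ‖x - y‖ ^ 2)) ≤ t * (f y - f x) := by nlinarith
    exact le_of_mul_le_mul_left h4 h0
  have hlim : Filter.Tendsto (fun t : ℝ => (1 - t) * (m / 2 * ‖x - y‖ ^ 2))
      (nhdsWithin 0 (Set.Ioi 0)) (nhds ((1 - 0) * (m / 2 * ‖x - y‖ ^ 2))) :=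
    Filter.Tendsto.mono_left (Continuous.tendsto (by fun_prop) 0) nhdsWithin_le_nhds
  rw [sub_zero, one_mul] at hlim
  exact le_of_tendsto hlim (by
    filter_upwards [Ioo_mem_nhdsGT (zero_lt_one (α := ℝ))] with t ht using key t ht)

end Minimizers

/-! ### Empirical loss and stability of its minimizer -/

section EmpiricalLoss

variable {p n : ℕ} {X : Type u} {C : Set (EuclideanSpace ℝ (Fin p))}
  {ℓ : EuclideanSpace ℝ (Fin p) → X → ℝ} {L Δ : ℝ}

theorem IsLipschitzLoss.mono {C' : Set (EuclideanSpace ℝ (Fin p))} (h : IsLipschitzLoss ℓ L C)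
    (hC : C' ⊆ C) : IsLipschitzLoss ℓ L C' :=
  fun d x hx y hy => h d x (hC hx) y (hC hy)

theorem abs_empLoss_sub_le (h : IsLipschitzLoss ℓ L C) (D : Fin n → X)
    {x y : EuclideanSpace ℝ (Fin p)} (hx : x ∈ C) (hy : y ∈ C) :
    |empLoss ℓ D x - empLoss ℓ D y| ≤ n * L * ‖x - y‖ := by
  simp only [empLoss, ← Finset.sum_sub_distrib]
  refine (Finset.abs_sum_le_sum_abs _ _).trans ?_
  refine (Finset.sum_le_sum fun i _ => h (D i) x hx y hy).trans_eq ?_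
  simp [mul_assoc]

theorem continuousOn_empLoss (h : IsLipschitzLoss ℓ L C) (D : Fin n → X) :
    ContinuousOn (empLoss ℓ D) C := by
  have : LipschitzOnWith (Real.toNNReal (n * L)) (empLoss ℓ D) C :=
    LipschitzOnWith.of_dist_le_mul fun x hx y hy => by
      rw [Real.dist_eq, dist_eq_norm]
      exact (abs_empLoss_sub_le h D hx hy).trans
        (mul_le_mul_of_nonneg_right (Real.le_coe_toNNReal _) (norm_nonneg _))
  exact this.continuousOn

theorem strongConvexOn_empLoss (hC : Convex ℝ C) (h : ∀ d, StrongConvexOn C Δ fun θ => ℓ θ d)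
    (D : Fin n → X) : StrongConvexOn C (n * Δ) (empLoss ℓ D) := by
  refine ⟨hC, fun x hx y hy a b ha hb hab => ?_⟩
  simp only [empLoss, Finset.smul_sum]
  refine (Finset.sum_le_sum fun i _ => (h (D i)).2 hx hy ha hb hab).trans_eq ?_
  rw [Finset.sum_sub_distrib, Finset.sum_add_distrib]
  simp only [Finset.sum_const, Finset.card_univ, Fintype.card_fin, nsmul_eq_mul]
  ring

theorem convexOn_empLoss (hC : Convex ℝ C) (h : ∀ d, ConvexOn ℝ C fun θ => ℓ θ d)
    (D : Fin n → X) : ConvexOn ℝ C (empLoss ℓ D) := by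
  have := strongConvexOn_empLoss (Δ := 0) hC (fun d => strongConvexOn_zero.2 (h d)) D
  rwa [mul_zero, strongConvexOn_zero] at this

theorem convexOn_of_strongConvexOn {f : EuclideanSpace ℝ (Fin p) → ℝ} (hΔ : 0 ≤ Δ)
    (h : StrongConvexOn C Δ f) : ConvexOn ℝ C f :=
  strongConvexOn_zero.1 (h.mono hΔ)

theorem empLoss_sub_empLoss_of_neighbors {D D' : Fin n → X} {i : Fin n}
    (h : ∀ j, j ≠ i → D j = D' j) (x : EuclideanSpace ℝ (Fin p)) :
    empLoss ℓ D x - empLoss ℓ D' x = ℓ x (D i) - ℓ x (D' i) := by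
  simp only [empLoss, ← Finset.sum_sub_distrib]
  refine Finset.sum_eq_single i (fun j _ hj => ?_) (by simp)
  rw [h j hj, sub_self]

theorem argminOn_empLoss_spec (hC : IsCompact C) (hne : C.Nonempty) (h : IsLipschitzLoss ℓ L C)
    (D : Fin n → X) : argminOn C (empLoss ℓ D) ∈ C ∧
      IsMinOn (empLoss ℓ D) C (argminOn C (empLoss ℓ D)) :=
  argminOn_spec hC hne (continuousOn_empLoss h D)

/-- Evaluate the quadratic growth of each loss at the other's minimizer and add. All entries but the
changed one cancel, which leaves `nΔ ‖x - y‖ ^ 2 ≤ 2L ‖x - y‖`. -/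
theorem norm_argminOn_sub_argminOn_le (hC : IsBody C) (hL : IsLipschitzLoss ℓ L C)
    (hL0 : 0 < L) (hΔ : 0 < Δ) (hn : 0 < n) (h : ∀ d, StrongConvexOn C Δ fun θ => ℓ θ d)
    {D D' : Fin n → X} (hD : Neighbors D D') :
    ‖argminOn C (empLoss ℓ D) - argminOn C (empLoss ℓ D')‖ ≤ 2 * L / (n * Δ) := by
  have hne : C.Nonempty := hC.2.2.mono interior_subset
  obtain ⟨hx, hxmin⟩ := argminOn_empLoss_spec hC.2.1 hne hL D
  obtain ⟨hy, hymin⟩ := argminOn_empLoss_spec hC.2.1 hne hL D'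
  set x := argminOn C (empLoss ℓ D)
  set y := argminOn C (empLoss ℓ D')
  obtain ⟨i, hi⟩ := hD
  have h1 := strongConvexOn_sub_min_le (strongConvexOn_empLoss hC.1 h D) hx hxmin hy
  have h2 := strongConvexOn_sub_min_le (strongConvexOn_empLoss hC.1 h D') hy hymin hx
  have h3 := empLoss_sub_empLoss_of_neighbors (ℓ := ℓ) hi x
  have h4 := empLoss_sub_empLoss_of_neighbors (ℓ := ℓ) hi y
  have h5 := (abs_le.1 (hL (D i) x hx y hy)).1
  have h6 := (abs_le.1 (hL (D' i) x hx y hy)).2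
  rw [norm_sub_rev y x] at h2
  have hn' : (0 : ℝ) < n := Nat.cast_pos.2 hn
  rw [le_div_iff₀ (by positivity)]
  rcases (norm_nonneg (x - y)).eq_or_lt with h | h
  · rw [← h, zero_mul]; positivity
  · refine le_of_mul_le_mul_right ?_ h
    nlinarith

end EmpiricalLoss


/-! ### Law and tail of the noise norm -/

section Noise

variable {p : ℕ} {r : ℝ}

/-- Polar coordinates. The choice `f = 1` gives the normalizing constant, an indicator gives the law
of the norm. -/
theorem integral_exp_neg_mul_norm_mul (hp : 1 ≤ p) (r : ℝ) (f : ℝ → ℝ) :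
    ∫ b : EuclideanSpace ℝ (Fin p), Real.exp (-r * ‖b‖) * f ‖b‖ =
      p * volume.real (Metric.ball (0 : EuclideanSpace ℝ (Fin p)) 1) *
        ∫ y in Set.Ioi (0 : ℝ), y ^ ((p : ℝ) - 1) * Real.exp (-(r * y)) * f y := by
  have : NeZero p := ⟨by omega⟩
  rw [integral_fun_norm_addHaar volume (fun y => Real.exp (-r * y) * f y)]
  simp only [finrank_euclideanSpace, Fintype.card_fin, nsmul_eq_mul, smul_eq_mul]
  rw [← mul_assoc]
  congr 1
  refine setIntegral_congr_fun measurableSet_Ioi fun y hy => ?_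
  rw [← Nat.cast_pred (by omega), Real.rpow_natCast, neg_mul, mul_assoc]

theorem integral_exp_neg_mul_norm (hp : 1 ≤ p) (hr : 0 < r) :
    ∫ b : EuclideanSpace ℝ (Fin p), Real.exp (-r * ‖b‖) =
      p * volume.real (Metric.ball (0 : EuclideanSpace ℝ (Fin p)) 1) *
        ((1 / r) ^ (p : ℝ) * Real.Gamma p) := by
  have h := integral_exp_neg_mul_norm_mul hp r 1
  simp only [Pi.one_apply, mul_one] at h
  rw [h, Real.integral_rpow_mul_exp_neg_mul_Ioi (by positivity) hr]

theorem volume_real_ball_pos : 0 < volume.real (Metric.ball (0 : EuclideanSpace ℝ (Fin p)) 1) :=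
  ENNReal.toReal_pos (Metric.measure_ball_pos _ _ one_pos).ne' measure_ball_lt_top.ne

theorem integrable_exp_neg_mul_norm (hp : 1 ≤ p) (hr : 0 < r) :
    Integrable fun b : EuclideanSpace ℝ (Fin p) => Real.exp (-r * ‖b‖) := by
  refine Integrable.of_integral_ne_zero ?_
  rw [integral_exp_neg_mul_norm hp hr]
  have := volume_real_ball_pos (p := p)
  have hp' : (0 : ℝ) < p := by positivity
  have := Real.Gamma_pos_of_pos hp'
  positivity

theorem isProbabilityMeasure_noise (hp : 1 ≤ p) (hr : 0 < r) :
    IsProbabilityMeasure (noise p r) :=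
  isProbabilityMeasure_tilted (integrable_exp_neg_mul_norm hp hr)

/-- The norm of the noise vector is Gamma distributed. -/
theorem map_norm_noise (hp : 1 ≤ p) (hr : 0 < r) :
    (noise p r).map (fun b => ‖b‖) = gammaMeasure p r := by
  ext S hS
  have hp' : (0 : ℝ) < p := by positivity
  have hΓ := Real.Gamma_pos_of_pos hp'
  have hV := volume_real_ball_pos (p := p)
  have hS' : MeasurableSet ((fun b : EuclideanSpace ℝ (Fin p) => ‖b‖) ⁻¹' S) :=
    measurable_norm hS
  have hint : Integrable (gammaPDFReal p r) := by
    refine ⟨(measurable_gammaPDFReal _ _).aestronglyMeasurable, ?_⟩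
    rw [hasFiniteIntegral_iff_ofReal (ae_of_all _ (gammaPDFReal_nonneg hp' hr))]
    exact (lintegral_gammaPDF_eq_one hp' hr).trans_lt ENNReal.one_lt_top
  rw [Measure.map_apply measurable_norm hS, noise, tilted_apply_eq_ofReal_integral' _ hS',
    gammaMeasure, withDensity_apply _ hS]
  simp only [gammaPDF]
  rw [← ofReal_integral_eq_lintegral_ofReal hint.integrableOn
    (ae_of_all _ (gammaPDFReal_nonneg hp' hr))]
  congr 1
  rw [integral_div, ← integral_indicator hS', ← integral_indicator hS,
    integral_exp_neg_mul_norm hp hr]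
  have h1 : ∀ b : EuclideanSpace ℝ (Fin p),
      ((fun b : EuclideanSpace ℝ (Fin p) => ‖b‖) ⁻¹' S).indicator
        (fun b => Real.exp (-r * ‖b‖)) b = Real.exp (-r * ‖b‖) * S.indicator 1 ‖b‖ := by
    intro b
    by_cases hb : ‖b‖ ∈ S <;> simp [hb]
  simp only [h1]
  rw [integral_exp_neg_mul_norm_mul hp r]
  have h2 : ∫ y, S.indicator (gammaPDFReal p r) y =
      ∫ y in Set.Ici (0 : ℝ), S.indicator (gammaPDFReal p r) y := by
    refine (setIntegral_eq_integral_of_forall_compl_eq_zero fun y hy => ?_).symm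
    have : ¬ 0 ≤ y := hy
    simp [gammaPDFReal, this]
  have h3 : ∫ y in Set.Ioi (0 : ℝ), S.indicator (gammaPDFReal p r) y =
      r ^ (p : ℝ) / Real.Gamma p * ∫ y in Set.Ioi (0 : ℝ),
        y ^ ((p : ℝ) - 1) * Real.exp (-(r * y)) * S.indicator 1 y := by
    rw [← integral_const_mul]
    refine setIntegral_congr_fun measurableSet_Ioi fun y hy => ?_
    have : 0 ≤ y := le_of_lt hy
    by_cases hyS : y ∈ S <;> simp [hyS, gammaPDFReal, this, mul_assoc]
  rw [h2, integral_Ici_eq_integral_Ioi, h3, Real.div_rpow zero_le_one hr.le, Real.one_rpow]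
  field_simp

/-- Tail bound for the norm of the noise vector. -/
theorem lintegral_norm_noise_tail_le (hp : 1 ≤ p) (hr : 0 < r) {x : ℝ} (hx : 2 ≤ x) :
    ∫⁻ b in {b : EuclideanSpace ℝ (Fin p) | p * x / r < ‖b‖}, ENNReal.ofReal ‖b‖ ∂(noise p r) ≤
      ENNReal.ofReal (2 * (p * x / r) * Real.exp (1 - x)) := by
  set R : ℝ := p * x / r with hR
  have hp' : (0 : ℝ) < p := by positivity
  have hΓ := Real.Gamma_pos_of_pos hp'
  have hRpos : 0 < R := by positivity
  have hmap : ∫⁻ b in {b : EuclideanSpace ℝ (Fin p) | R < ‖b‖}, ENNReal.ofReal ‖b‖ ∂(noise p r) =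
      ∫⁻ y in Set.Ioi R, ENNReal.ofReal y ∂(gammaMeasure p r) := by
    rw [← map_norm_noise hp hr, setLIntegral_map measurableSet_Ioi ENNReal.measurable_ofReal
      measurable_norm]
    rfl
  have hmeas : Measurable (gammaPDF p r) := (measurable_gammaPDFReal _ _).ennreal_ofReal
  rw [hmap, gammaMeasure, setLIntegral_withDensity_eq_setLIntegral_mul _ hmeas
    ENNReal.measurable_ofReal measurableSet_Ioi]
  -- Since `p / R = r / x`, replacing `y ^ p` by `R ^ p * exp (p * (y / R - 1))` uses up `r / x` of
  -- the decay rate `r`; `x ≥ 2` keeps at least half.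
  set c : ℝ := r - r / x with hc
  have hx0 : 0 < x := by linarith
  have hcpos : r / 2 ≤ c := by
    have : r / x ≤ r / 2 := div_le_div_of_nonneg_left hr.le two_pos hx
    linarith
  have hc0 : 0 < c := by linarith
  set M : ℝ := r ^ p / Real.Gamma p * (R ^ p * Real.exp (-p)) with hM
  have hM0 : 0 ≤ M := by positivity
  have hbound : ∀ y ∈ Set.Ioi R, (gammaPDF p r * ENNReal.ofReal) y ≤
      ENNReal.ofReal (M * Real.exp (-c * y)) := by
    intro y hy
    have hy : R < y := hy
    have hy0 : 0 < y := hRpos.trans hy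
    rw [Pi.mul_apply, gammaPDF_of_nonneg hy0.le, ← ENNReal.ofReal_mul (by positivity)]
    refine ENNReal.ofReal_le_ofReal ?_
    have h1 : y ^ p ≤ R ^ p * Real.exp (p * (y / R - 1)) := by
      have h2 : y / R ≤ Real.exp (y / R - 1) := by
        have := Real.add_one_le_exp (y / R - 1)
        linarith
      have h3 : (y / R) ^ p ≤ Real.exp (y / R - 1) ^ p :=
        pow_le_pow_left₀ (by positivity) h2 p
      rw [← Real.exp_nat_mul, div_pow, div_le_iff₀ (by positivity)] at h3
      linarith
    have h4 : y ^ ((p : ℝ) - 1) * y = y ^ p := by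
      rw [← Real.rpow_natCast, Real.rpow_sub_one hy0.ne']
      field_simp
    calc r ^ (p : ℝ) / Real.Gamma p * y ^ ((p : ℝ) - 1) * Real.exp (-(r * y)) * y
        = r ^ p / Real.Gamma p * y ^ p * Real.exp (-(r * y)) := by
          rw [← h4, Real.rpow_natCast]; ring
      _ ≤ r ^ p / Real.Gamma p * (R ^ p * Real.exp (p * (y / R - 1))) * Real.exp (-(r * y)) := by
          gcongr
      _ = M * Real.exp (-c * y) := by
          have : Real.exp (p * (y / R - 1)) * Real.exp (-(r * y)) =
              Real.exp (-p) * Real.exp (-c * y) := by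
            rw [← Real.exp_add, ← Real.exp_add]
            congr 1
            rw [hc, hR]
            field_simp
            ring
          rw [hM]
          linear_combination r ^ p / Real.Gamma p * R ^ p * this
  refine (setLIntegral_mono (by fun_prop) hbound).trans ?_
  rw [← ofReal_integral_eq_lintegral_ofReal
    ((integrableOn_exp_mul_Ioi (neg_neg_of_pos hc0) R).const_mul M)
    (ae_of_all _ fun y => by positivity)]
  refine ENNReal.ofReal_le_ofReal ?_
  rw [integral_const_mul, integral_exp_mul_Ioi (neg_neg_of_pos hc0)]
  -- A Stirling-type bound: `p ^ p / p!` is one term of the series of `exp p`.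
  have hfac : (p : ℝ) ^ p / Real.Gamma p ≤ p * Real.exp p := by
    have h5 := Real.pow_div_factorial_le_exp (p : ℝ) hp'.le p
    have h6 : (p.factorial : ℝ) = p * Real.Gamma p := by
      rw [← Real.Gamma_nat_eq_factorial, Real.Gamma_add_one hp'.ne']
    rw [h6, div_le_iff₀ (by positivity)] at h5
    rw [div_le_iff₀ hΓ]
    linarith
  have hxe : x * Real.exp (1 - x) ≤ 1 := by
    have := Real.add_one_le_exp (x - 1)
    have h7 : Real.exp (1 - x) * Real.exp (x - 1) = 1 := by
      rw [← Real.exp_add]; simp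
    nlinarith [Real.exp_pos (1 - x)]
  -- The base is at most `1` and `p ≥ 1`, so the power can be dropped and the decay `exp (1 - x)` is
  -- free of `p`.
  have hpow : (x * Real.exp (1 - x)) ^ p ≤ x * Real.exp (1 - x) :=
    pow_le_of_le_one (by positivity) hxe (by omega)
  calc M * (-Real.exp (-c * R) / -c)
      = (p : ℝ) ^ p / Real.Gamma p * (x ^ p * (Real.exp (-p) * Real.exp (-c * R))) * (1 / c) := by
        have : r ^ p * R ^ p = (p : ℝ) ^ p * x ^ p := by
          rw [← mul_pow, ← mul_pow, hR]
          field_simp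
        rw [neg_div_neg_eq, hM]
        linear_combination 1 / Real.Gamma p * Real.exp (-p) * Real.exp (-c * R) * (1 / c) * this
    _ = (p : ℝ) ^ p / Real.Gamma p * (x ^ p * Real.exp (-(p * x))) * (1 / c) := by
        rw [← Real.exp_add]
        congr 4
        rw [hc, hR]
        field_simp
        ring
    _ ≤ p * Real.exp p * (x ^ p * Real.exp (-(p * x))) * (1 / (r / 2)) := by
        gcongr
    _ = 2 * p / r * (x * Real.exp (1 - x)) ^ p := by
        have : Real.exp p * Real.exp (-(p * x)) = Real.exp (1 - x) ^ p := by
          rw [← Real.exp_nat_mul, ← Real.exp_add]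
          ring_nf
        rw [mul_pow, ← this]
        field_simp
    _ ≤ 2 * p / r * (x * Real.exp (1 - x)) := by gcongr
    _ = 2 * R * Real.exp (1 - x) := by rw [hR]; ring

end Noise


/-! ### Privacy of output perturbation -/

section OutputPerturbation

variable {p n : ℕ} {r : ℝ} {X : Type u} {C : Set (EuclideanSpace ℝ (Fin p))}
  {ℓ : EuclideanSpace ℝ (Fin p) → X → ℝ} {L Δ ε : ℝ}

theorem noise_preimage_add (r : ℝ) (v : EuclideanSpace ℝ (Fin p))
    {S : Set (EuclideanSpace ℝ (Fin p))} (hS : MeasurableSet S) :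
    noise p r ((fun b => v + b) ⁻¹' S) = ∫⁻ y in S, ENNReal.ofReal
      (Real.exp (-r * ‖y - v‖) / ∫ b : EuclideanSpace ℝ (Fin p), Real.exp (-r * ‖b‖)) := by
  have hS' : MeasurableSet ((fun b => v + b) ⁻¹' S) := measurable_const_add v hS
  rw [noise, tilted_apply' _ _ hS', ← lintegral_indicator hS', ← lintegral_indicator hS,
    ← lintegral_add_left_eq_self (S.indicator _) v]
  refine lintegral_congr fun b => ?_
  by_cases hb : v + b ∈ S <;> simp [hb]

/-- The two translated densities share a normalizing constant, so the triangle inequality in the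
exponent bounds their ratio. -/
theorem noise_preimage_add_le (hr : 0 ≤ r) {v w : EuclideanSpace ℝ (Fin p)} {t : ℝ}
    (h : r * ‖v - w‖ ≤ t) {S : Set (EuclideanSpace ℝ (Fin p))} (hS : MeasurableSet S) :
    noise p r ((fun b => v + b) ⁻¹' S) ≤
      ENNReal.ofReal (Real.exp t) * noise p r ((fun b => w + b) ⁻¹' S) := by
  rw [noise_preimage_add r v hS, noise_preimage_add r w hS, ← lintegral_const_mul' _ _
    ENNReal.ofReal_ne_top]
  refine lintegral_mono fun y => ?_
  rw [← ENNReal.ofReal_mul (Real.exp_pos t).le, ← mul_div_assoc, ← Real.exp_add]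
  refine ENNReal.ofReal_le_ofReal (div_le_div_of_nonneg_right (Real.exp_le_exp.2 ?_)
    (integral_nonneg fun b => (Real.exp_pos _).le))
  have h1 : ‖y - w‖ ≤ ‖y - v‖ + ‖v - w‖ := norm_sub_le_norm_sub_add_norm_sub _ _ _
  nlinarith

theorem measurable_proj_add (hC : IsBody C) (v : EuclideanSpace ℝ (Fin p)) :
    Measurable fun b => proj C (v + b) :=
  ((continuous_proj hC.2.1 hC.1 (hC.2.2.mono interior_subset)).comp (by fun_prop)).measurable

theorem isProbabilityMeasure_perturbedMin (hC : IsBody C) (hp : 1 ≤ p) (hn : 0 < n) (hL : 0 < L)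
    (hΔ : 0 < Δ) (hε : 0 < ε) (D : Fin n → X) :
    IsProbabilityMeasure (perturbedMin ℓ L Δ ε C D) := by
  have hn' : (0 : ℝ) < n := Nat.cast_pos.2 hn
  have := isProbabilityMeasure_noise (r := n * Δ * ε / (2 * L)) hp (by positivity)
  exact Measure.isProbabilityMeasure_map (measurable_proj_add hC _).aemeasurable

theorem perturbedMin_compl (hC : IsBody C) (D : Fin n → X) :
    perturbedMin ℓ L Δ ε C D Cᶜ = 0 := by
  rw [perturbedMin, Measure.map_apply (measurable_proj_add hC _)
    hC.2.1.isClosed.measurableSet.compl]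
  convert measure_empty (μ := noise p (n * Δ * ε / (2 * L)))
  ext b
  simpa using proj_mem hC.2.1 (hC.2.2.mono interior_subset) _

theorem perturbedMin_restrict (hC : IsBody C) (D : Fin n → X) :
    (perturbedMin ℓ L Δ ε C D).restrict C = perturbedMin ℓ L Δ ε C D :=
  Measure.restrict_eq_self_of_ae_mem (perturbedMin_compl hC D)

/-- The noise rate times the stability bound of the minimizer is exactly `ε`. Projecting only
replaces `S` by its preimage. -/
theorem isDP_perturbedMin (hC : IsBody C) (hn : 0 < n) (hL : 0 < L)
    (hΔ : 0 < Δ) (hε : 0 < ε) (hlip : IsLipschitzLoss ℓ L C)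
    (hsc : ∀ d, StrongConvexOn C Δ fun θ => ℓ θ d) :
    IsDP ε (perturbedMin (n := n) ℓ L Δ ε C) := by
  intro D D' hD S hS
  have hn' : (0 : ℝ) < n := Nat.cast_pos.2 hn
  have hcont := continuous_proj hC.2.1 hC.1 (hC.2.2.mono interior_subset)
  rw [perturbedMin, perturbedMin, Measure.map_apply (measurable_proj_add hC _) hS,
    Measure.map_apply (measurable_proj_add hC _) hS]
  refine noise_preimage_add_le (S := proj C ⁻¹' S) (by positivity) ?_ (hcont.measurable hS)
  calc n * Δ * ε / (2 * L) * ‖argminOn C (empLoss ℓ D) - argminOn C (empLoss ℓ D')‖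
      ≤ n * Δ * ε / (2 * L) * (2 * L / (n * Δ)) := by
        gcongr
        exact norm_argminOn_sub_argminOn_le hC hlip hL hΔ hn hsc hD
    _ = ε := by field_simp

end OutputPerturbation

/-! ### Adaptive composition -/

section Composition

variable {n : ℕ} {X : Type u} {Ω Θ : Type*} [MeasurableSpace Ω] [MeasurableSpace Θ] {ε ε' : ℝ}

/-- Adaptive composition of two differentially private algorithms. -/
theorem isDP_bind {M : (Fin n → X) → Measure Ω} {N : Ω → (Fin n → X) → Measure Θ}
    (hM : IsDP ε M) (hmeas : ∀ D, AEMeasurable (fun ω => N ω D) (M D))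
    (hN : ∀ D, ∀ᵐ ω ∂(M D), IsDP ε' (N ω)) :
    IsDP (ε + ε') fun D => (M D).bind fun ω => N ω D := by
  intro D D' hD S hS
  have hle : M D ≤ ENNReal.ofReal (Real.exp ε) • M D' :=
    Measure.le_intro fun T hT _ => by simpa using hM D D' hD T hT
  rw [Measure.bind_apply hS (hmeas D), Measure.bind_apply hS (hmeas D'), Real.exp_add,
    ENNReal.ofReal_mul (Real.exp_pos _).le]
  calc ∫⁻ ω, N ω D S ∂(M D)
      ≤ ∫⁻ ω, ENNReal.ofReal (Real.exp ε') * N ω D' S ∂(M D) :=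
        lintegral_mono_ae ((hN D).mono fun ω hω => hω D D' hD S hS)
    _ = ENNReal.ofReal (Real.exp ε') * ∫⁻ ω, N ω D' S ∂(M D) :=
        lintegral_const_mul' _ _ ENNReal.ofReal_ne_top
    _ ≤ ENNReal.ofReal (Real.exp ε') * ∫⁻ ω, N ω D' S ∂(ENNReal.ofReal (Real.exp ε) • M D') := by
        gcongr
    _ = _ := by
        rw [lintegral_smul_measure, smul_eq_mul]
        ring

theorem bind_compl_eq_zero {μ : Measure Ω} {N : Ω → Measure Θ} (hN : AEMeasurable N μ)
    {C : Set Θ} (hC : MeasurableSet C) (h : ∀ᵐ ω ∂μ, N ω Cᶜ = 0) : μ.bind N Cᶜ = 0 := by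
  rw [Measure.bind_apply hC.compl hN]
  exact lintegral_eq_zero_of_ae_eq_zero h

theorem isProbabilityMeasure_bind_of_ae {μ : Measure Ω} [IsProbabilityMeasure μ]
    {N : Ω → Measure Θ} (hN : AEMeasurable N μ) (h : ∀ᵐ ω ∂μ, IsProbabilityMeasure (N ω)) :
    IsProbabilityMeasure (μ.bind N) := by
  constructor
  rw [Measure.bind_apply MeasurableSet.univ hN,
    lintegral_congr_ae (h.mono fun ω hω => hω.measure_univ)]
  simp

end Composition

/-! ### The localized set and privacy of the two-step algorithm -/

section Localization

variable {p n : ℕ} {X : Type u} {C : Set (EuclideanSpace ℝ (Fin p))}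
  {ℓ : EuclideanSpace ℝ (Fin p) → X → ℝ} {L Δ ε : ℝ}

theorem locSet_eq (n : ℕ) (L : ℝ) {Δ ε : ℝ} (C : Set (EuclideanSpace ℝ (Fin p)))
    (θ₀ : EuclideanSpace ℝ (Fin p)) : locSet n L Δ ε C θ₀ =
      C ∩ Metric.closedBall θ₀ (12 * (L * p * Real.log n / (Δ * ε * n))) := by
  -- `12 = 3 * 2 * 2`: the last factor comes from running the first step with `ε / 2`.
  have : 3 * Real.log n * (2 * L * p / (Δ * (ε / 2) * n)) =
      12 * (L * p * Real.log n / (Δ * ε * n)) := by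
    rw [show Δ * (ε / 2) * n = Δ * ε * n / 2 by ring, div_div_eq_mul_div]
    ring
  ext θ
  simp [locSet, localSet, this, dist_eq_norm]

/-- The centre may lie on the boundary of `C`, but the interior of a convex body is dense in it, so
every ball around the centre meets the interior. -/
theorem isBody_inter_closedBall (hC : IsBody C) {r : ℝ} (hr : 0 < r)
    {θ₀ : EuclideanSpace ℝ (Fin p)} (hθ : θ₀ ∈ C) : IsBody (C ∩ Metric.closedBall θ₀ r) := by
  refine ⟨hC.1.inter (convex_closedBall _ _), hC.2.1.inter_right Metric.isClosed_closedBall, ?_⟩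
  have h1 : θ₀ ∈ closure (interior C) := by
    rw [hC.1.closure_interior_eq_closure_of_nonempty_interior hC.2.2]
    exact subset_closure hθ
  obtain ⟨y, hy, hyC⟩ := mem_closure_iff.1 h1 (Metric.ball θ₀ r) Metric.isOpen_ball
    (Metric.mem_ball_self hr)
  rw [interior_inter]
  exact ⟨y, hyC, Metric.ball_subset_interior_closedBall hy⟩

theorem radius_pos (hp : 1 ≤ p) (hn : 2 ≤ n) (hL : 0 < L) (hΔ : 0 < Δ) (hε : 0 < ε) :
    0 < 12 * (L * p * Real.log n / (Δ * ε * n)) := by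
  have : 0 < Real.log n := Real.log_pos (by exact_mod_cast hn)
  positivity

theorem isBody_locSet (hC : IsBody C) (hp : 1 ≤ p) (hn : 2 ≤ n) (hL : 0 < L) (hΔ : 0 < Δ)
    (hε : 0 < ε) {θ₀ : EuclideanSpace ℝ (Fin p)} (hθ : θ₀ ∈ C) :
    IsBody (locSet n L Δ ε C θ₀) := by
  rw [locSet_eq]
  exact isBody_inter_closedBall hC (radius_pos hp hn hL hΔ hε) hθ

theorem locSet_subset (θ₀ : EuclideanSpace ℝ (Fin p)) : locSet n L Δ ε C θ₀ ⊆ C :=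
  fun _ h => h.1

/-- Measurability on the subtype `C` suffices because the law of `θ₀` is carried by `C`. -/
theorem IsComposable.aemeasurable {A : LipAlgorithm.{u} p n} (h : IsComposable A ℓ L Δ ε C)
    (hC : IsBody C) (D : Fin n → X) :
    AEMeasurable (fun θ₀ => A X ℓ L (ε / 2) (locSet n L Δ ε C θ₀) D)
      (perturbedMin ℓ L Δ (ε / 2) C D) := by
  rw [← perturbedMin_restrict hC D,
    aemeasurable_restrict_iff_comap_subtype hC.2.1.isClosed.measurableSet]
  exact (h D).aemeasurable

theorem ae_perturbedMin_mem (hC : IsBody C) (D : Fin n → X) :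
    ∀ᵐ θ₀ ∂(perturbedMin ℓ L Δ ε C D), θ₀ ∈ C :=
  perturbedMin_compl hC D

theorem isPrivateSolver_localization {A : LipAlgorithm.{u} p n} (hC : IsBody C) (hp : 1 ≤ p)
    (hn : 2 ≤ n) (hL : 0 < L) (hΔ : 0 < Δ) (hε : 0 < ε) (hlip : IsLipschitzLoss ℓ L C)
    (hsc : ∀ d, StrongConvexOn C Δ fun θ => ℓ θ d) (hcomp : IsComposable A ℓ L Δ ε C)
    (hA : ∀ C' ⊆ C, IsBody C' → IsPrivateSolver A ℓ L (ε / 2) C') :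
    IsPrivateSolver (localization A Δ) ℓ L ε C := by
  have hA' : ∀ θ₀ ∈ C, IsPrivateSolver A ℓ L (ε / 2) (locSet n L Δ ε C θ₀) := fun θ₀ hθ =>
    hA _ (locSet_subset θ₀) (isBody_locSet hC hp hn hL hΔ hε hθ)
  refine ⟨fun D => ⟨?_, ?_⟩, ?_⟩
  · have := isProbabilityMeasure_perturbedMin (ℓ := ℓ) hC hp (by omega : 0 < n) hL hΔ
      (half_pos hε) D
    exact isProbabilityMeasure_bind_of_ae (hcomp.aemeasurable hC D)
      ((ae_perturbedMin_mem hC D).mono fun θ₀ hθ => ((hA' θ₀ hθ).1 D).1)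
  · exact bind_compl_eq_zero (hcomp.aemeasurable hC D) hC.2.1.isClosed.measurableSet
      ((ae_perturbedMin_mem hC D).mono fun θ₀ hθ =>
        measure_mono_null (Set.compl_subset_compl.2 (locSet_subset θ₀)) ((hA' θ₀ hθ).1 D).2)
  · have h := isDP_bind
      (isDP_perturbedMin hC (by omega : 0 < n) hL hΔ (half_pos hε) hlip hsc)
      (fun D => hcomp.aemeasurable hC D)
      (fun D => (ae_perturbedMin_mem hC D).mono fun θ₀ hθ => (hA' θ₀ hθ).2)
    rwa [add_halves] at h

end Localization


/-! ### Exponential weights on convex bodies -/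

section Tilting

variable {p : ℕ} {C : Set (EuclideanSpace ℝ (Fin p))} {f g : EuclideanSpace ℝ (Fin p) → ℝ}

theorem IsBody.neZero_restrict (hC : IsBody C) :
    NeZero ((volume : Measure (EuclideanSpace ℝ (Fin p))).restrict C) := by
  refine ⟨fun h => ?_⟩
  rw [Measure.restrict_eq_zero] at h
  exact (isOpen_interior.measure_pos volume hC.2.2).ne' (measure_mono_null interior_subset h)

theorem IsBody.measurableSet (hC : IsBody C) : MeasurableSet C := hC.2.1.isClosed.measurableSet

theorem isProbabilityMeasure_tilted_body (hC : IsBody C) (hf : ContinuousOn f C) :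
    IsProbabilityMeasure ((volume.restrict C).tilted f) := by
  have := hC.neZero_restrict
  exact isProbabilityMeasure_tilted (hf.rexp.integrableOn_compact hC.2.1)

theorem tilted_body_compl (hC : IsBody C) (f : EuclideanSpace ℝ (Fin p) → ℝ) :
    (volume.restrict C).tilted f Cᶜ = 0 :=
  tilted_absolutelyContinuous _ _ (by simp [Measure.restrict_apply hC.measurableSet.compl])

/-- The exponential mechanism: oscillation bounds give bounds on the density ratio. -/
theorem tilted_body_le (hC : IsBody C) (hf : ContinuousOn f C) (hg : ContinuousOn g C) {t : ℝ}
    (h : ∀ x ∈ C, ∀ y ∈ C, (f x - g x) - (f y - g y) ≤ t)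
    {S : Set (EuclideanSpace ℝ (Fin p))} (hS : MeasurableSet S) :
    (volume.restrict C).tilted f S ≤
      ENNReal.ofReal (Real.exp t) * (volume.restrict C).tilted g S := by
  have := hC.neZero_restrict
  have hfi : Integrable (fun x => Real.exp (f x)) (volume.restrict C) :=
    hf.rexp.integrableOn_compact hC.2.1
  have hgi : Integrable (fun x => Real.exp (g x)) (volume.restrict C) :=
    hg.rexp.integrableOn_compact hC.2.1
  have hZf := integral_exp_pos hfi
  have hZg := integral_exp_pos hgi
  rw [tilted_apply' _ _ hS, tilted_apply' _ _ hS, ← lintegral_const_mul' _ _ ENNReal.ofReal_ne_top]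
  refine lintegral_mono_ae ?_
  filter_upwards [ae_restrict_of_ae (ae_restrict_mem hC.measurableSet)] with x hx
  rw [← ENNReal.ofReal_mul (Real.exp_pos t).le]
  refine ENNReal.ofReal_le_ofReal ?_
  -- Cross-multiplying pairs the weight at `x` with the normalizer's integrand at `y`, so one
  -- oscillation bound serves both and the loss is `t`, not `2t`.
  rw [← mul_div_assoc, div_le_div_iff₀ hZf hZg, ← integral_const_mul, ← integral_const_mul]
  refine setIntegral_mono_on (hgi.const_mul _) (hfi.const_mul _) hC.measurableSet fun y hy => ?_
  rw [← Real.exp_add, ← Real.exp_add, ← Real.exp_add]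
  exact Real.exp_le_exp.2 (by linarith [h x hx y hy])

/-- The contraction `x ↦ (x + z) / 2` maps `C` into itself and scales volume by `2 ^ (-p)`;
convexity bounds `f` at the midpoint by the average. -/
theorem integral_exp_halfway_le (hC : IsBody C) (hf : ContinuousOn f C) (hconv : ConvexOn ℝ C f)
    {κ : ℝ} (hκ : 0 ≤ κ) {z : EuclideanSpace ℝ (Fin p)} (hz : z ∈ C) :
    ∫ x in C, Real.exp (-κ * ((f x + f z) / 2)) ≤ 2 ^ p * ∫ x in C, Real.exp (-κ * f x) := by
  have hint : ∀ F : EuclideanSpace ℝ (Fin p) → ℝ, ContinuousOn F C →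
      Integrable (C.indicator F) := fun F hF =>
    (hF.integrableOn_compact hC.2.1).integrable_indicator hC.measurableSet
  have hg := hint (fun x => Real.exp (-κ * f x)) (by fun_prop)
  rw [← integral_indicator hC.measurableSet, ← integral_indicator hC.measurableSet]
  set G := C.indicator fun x => Real.exp (-κ * f x) with hG
  have h1 : ∫ x, G ((1 / 2 : ℝ) • x + (1 / 2 : ℝ) • z) = 2 ^ p * ∫ x, G x := by
    rw [Measure.integral_comp_smul volume (fun x => G (x + (1 / 2 : ℝ) • z)) (1 / 2 : ℝ),
      integral_add_right_eq_self]
    simp [abs_of_pos]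
  rw [← h1]
  refine integral_mono (hint _ (by fun_prop))
    ((hg.comp_add_right ((1 / 2 : ℝ) • z)).comp_smul (by norm_num : (1 / 2 : ℝ) ≠ 0)) fun x => ?_
  by_cases hx : x ∈ C
  · have hmem := hC.1 hx hz (by norm_num : (0 : ℝ) ≤ 1 / 2) (by norm_num : (0 : ℝ) ≤ 1 / 2)
      (by norm_num)
    have hle := hconv.2 hx hz (by norm_num : (0 : ℝ) ≤ 1 / 2) (by norm_num : (0 : ℝ) ≤ 1 / 2)
      (by norm_num)
    simp only [smul_eq_mul] at hle
    simp only [hG, Set.indicator_of_mem hx, Set.indicator_of_mem hmem]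
    refine Real.exp_le_exp.2 ?_
    nlinarith
  · rw [Set.indicator_of_notMem hx]
    exact Set.indicator_nonneg (fun _ _ => (Real.exp_pos _).le) _

/-- Under the law with density proportional to `exp (-κ f)` on a convex body, a convex function
`f` exceeds any of its values by at most `2 p / κ` in expectation. -/
theorem lintegral_tilted_sub_le (hC : IsBody C) (hf : ContinuousOn f C) (hconv : ConvexOn ℝ C f)
    {κ : ℝ} (hκ : 0 < κ) {z : EuclideanSpace ℝ (Fin p)} (hz : z ∈ C) (hmin : IsMinOn f C z) :
    ∫⁻ x, ENNReal.ofReal (f x - f z) ∂((volume.restrict C).tilted fun x => -κ * f x) ≤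
      ENNReal.ofReal (2 * p / κ) := by
  have := hC.neZero_restrict
  have hint : ∀ F : EuclideanSpace ℝ (Fin p) → ℝ, ContinuousOn F C →
      Integrable F (volume.restrict C) := fun F hF => hF.integrableOn_compact hC.2.1
  have hw := hint (fun x => Real.exp (-κ * f x)) (by fun_prop)
  have hZ := integral_exp_pos hw
  set Z := ∫ x in C, Real.exp (-κ * f x) with hZdef
  have hpos : ∀ x ∈ C, 0 ≤ f x - f z := fun x hx => sub_nonneg.2 (hmin hx)
  rw [lintegral_tilted]
  simp only [← hZdef, ← ENNReal.ofReal_mul (div_nonneg (Real.exp_pos _).le hZ.le)]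
  have hcont : ContinuousOn (fun x => Real.exp (-κ * f x) / Z * (f x - f z)) C := by fun_prop
  rw [← ofReal_integral_eq_lintegral_ofReal (hint _ hcont)
    ((ae_restrict_mem hC.measurableSet).mono fun x hx =>
      mul_nonneg (div_nonneg (Real.exp_pos _).le hZ.le) (hpos x hx))]
  refine ENNReal.ofReal_le_ofReal ?_
  set E : EuclideanSpace ℝ (Fin p) → ℝ := fun x => Real.exp (-κ * ((f x + f z) / 2)) with hE
  have hEi : Integrable E (volume.restrict C) := hint _ (by fun_prop)
  -- With `y = κ / 2 * (f x - f z)`, the inequality `1 + u ≤ exp u` at `u = y - p log 2` gives `y ≤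
  -- p - 1 + exp y / 2 ^ p`. The halfway lemma bounds the mean of `exp y` by `2 ^ p`, so the mean of
  -- `y` is at most `p`.
  have hpt : ∀ x, Real.exp (-κ * f x) / Z * (f x - f z) ≤
      2 / κ * ((p - 1) / Z * Real.exp (-κ * f x) + 1 / (2 ^ p * Z) * E x) := by
    intro x
    set y := κ / 2 * (f x - f z) with hy
    have h1 : y ≤ p - 1 + Real.exp y / 2 ^ p := by
      have h2 := Real.add_one_le_exp (y - p * Real.log 2)
      have h3 : Real.exp (y - p * Real.log 2) = Real.exp y / 2 ^ p := by
        rw [Real.exp_sub, Real.exp_nat_mul, Real.exp_log two_pos]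
      have h4 : (p : ℝ) * Real.log 2 ≤ p * 1 := by
        gcongr
        linarith [Real.log_two_lt_d9]
      linarith
    have h5 : E x = Real.exp (-κ * f x) * Real.exp y := by
      rw [hE, ← Real.exp_add, hy]
      ring_nf
    have h6 : f x - f z = 2 / κ * y := by rw [hy]; field_simp
    rw [h5, h6]
    calc Real.exp (-κ * f x) / Z * (2 / κ * y)
        = 2 / κ * (Real.exp (-κ * f x) / Z) * y := by ring
      _ ≤ 2 / κ * (Real.exp (-κ * f x) / Z) * (p - 1 + Real.exp y / 2 ^ p) := by gcongr
      _ = _ := by field_simp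
  have hbd := integral_exp_halfway_le hC hf hconv hκ.le hz
  calc ∫ x in C, Real.exp (-κ * f x) / Z * (f x - f z)
      ≤ ∫ x in C, 2 / κ * ((p - 1) / Z * Real.exp (-κ * f x) + 1 / (2 ^ p * Z) * E x) :=
        integral_mono (hint _ hcont) (((hw.const_mul _).add (hEi.const_mul _)).const_mul _) hpt
    _ = 2 / κ * ((p - 1) / Z * Z + 1 / (2 ^ p * Z) * ∫ x in C, E x) := by
        rw [integral_const_mul, integral_add (hw.const_mul _) (hEi.const_mul _),
          integral_const_mul, integral_const_mul]
    _ ≤ 2 / κ * ((p - 1) / Z * Z + 1 / (2 ^ p * Z) * (2 ^ p * Z)) := by gcongr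
    _ = 2 * p / κ := by field_simp; ring

end Tilting

/-! ### Privacy, risk and measurability of exponential sampling -/

section ExponentialSampling

variable {p n : ℕ} {X : Type u} {C : Set (EuclideanSpace ℝ (Fin p))}
  {ℓ : EuclideanSpace ℝ (Fin p) → X → ℝ} {L Δ ε : ℝ}

theorem isPrivateSolver_expSampling (hC : IsBody C) (hL : 0 < L) (hε : 0 ≤ ε)
    (hlip : IsLipschitzLoss ℓ L C) : IsPrivateSolver (expSampling p n) ℓ L ε C := by
  have hcont : ∀ D : Fin n → X, ContinuousOn
      (fun θ => -(ε / (2 * L * Metric.diam C)) * empLoss ℓ D θ) C := fun D =>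
    continuousOn_const.mul (continuousOn_empLoss hlip D)
  refine ⟨fun D => ⟨isProbabilityMeasure_tilted_body hC (hcont D), tilted_body_compl hC _⟩, ?_⟩
  rintro D D' ⟨i, hi⟩ S hS
  refine tilted_body_le hC (hcont D) (hcont D') (fun x hx y hy => ?_) hS
  have h1 := empLoss_sub_empLoss_of_neighbors (ℓ := ℓ) hi x
  have h2 := empLoss_sub_empLoss_of_neighbors (ℓ := ℓ) hi y
  have h3 := (abs_le.1 (hlip (D i) x hx y hy)).1
  have h4 := (abs_le.1 (hlip (D' i) x hx y hy)).2
  have h5 : ‖x - y‖ ≤ Metric.diam C := by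
    rw [← dist_eq_norm]
    exact Metric.dist_le_diam_of_mem hC.2.1.isBounded hx hy
  set κ := ε / (2 * L * Metric.diam C) with hκ
  have hκ0 : 0 ≤ κ := div_nonneg hε (mul_nonneg (by positivity) Metric.diam_nonneg)
  -- The diameter can vanish since `p = 0` is allowed here; then the quotient `κ` is `0`.
  have h6 : κ * (2 * L * Metric.diam C) ≤ ε := by
    rcases eq_or_ne (2 * L * Metric.diam C) 0 with h | h
    · rwa [h, mul_zero]
    · rw [hκ, div_mul_cancel₀ _ h]
  have h7 : -(2 * L * Metric.diam C) ≤
      (empLoss ℓ D x - empLoss ℓ D' x) - (empLoss ℓ D y - empLoss ℓ D' y) := by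
    rw [h1, h2]
    nlinarith
  nlinarith

theorem lintegral_expSampling_sub_le (hC : IsBody C) (hL : 0 < L) (hε : 0 < ε)
    (hlip : IsLipschitzLoss ℓ L C) (hconv : ∀ d, ConvexOn ℝ C fun θ => ℓ θ d) (D : Fin n → X)
    {z : EuclideanSpace ℝ (Fin p)} (hz : z ∈ C) (hmin : IsMinOn (empLoss ℓ D) C z) :
    ∫⁻ θ, ENNReal.ofReal (empLoss ℓ D θ - empLoss ℓ D z) ∂(expSampling p n X ℓ L ε C D) ≤
      ENNReal.ofReal (4 * p * L * Metric.diam C / ε) := by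
  rcases (Metric.diam_nonneg (s := C)).eq_or_lt with h0 | h0
  · have : ∀ᵐ θ ∂(expSampling p n X ℓ L ε C D),
        ENNReal.ofReal (empLoss ℓ D θ - empLoss ℓ D z) = 0 := by
      have hmem : ∀ᵐ θ ∂(expSampling p n X ℓ L ε C D), θ ∈ C := tilted_body_compl hC _
      filter_upwards [hmem] with θ hθ
      have h1 := (abs_le.1 (abs_empLoss_sub_le hlip D hθ hz)).2
      have h2 : ‖θ - z‖ ≤ Metric.diam C := by
        rw [← dist_eq_norm]
        exact Metric.dist_le_diam_of_mem hC.2.1.isBounded hθ hz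
      have h3 : ‖θ - z‖ = 0 := le_antisymm (h2.trans_eq h0.symm) (norm_nonneg _)
      rw [h3, mul_zero] at h1
      exact ENNReal.ofReal_eq_zero.2 h1
    rw [lintegral_eq_zero_of_ae_eq_zero this]
    exact zero_le
  · refine (lintegral_tilted_sub_le hC (continuousOn_empLoss hlip D)
      (convexOn_empLoss hC.1 hconv D) (κ := ε / (2 * L * Metric.diam C)) (by positivity)
      hz hmin).trans_eq ?_
    congr 1
    field_simp
    ring

/-- For `c > 0` the set where the diameter is at least `c` is the projection, along a compact
factor, of a closed set of triples (centre, two points realizing the distance), hence closed. -/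
theorem measurable_diam_inter_closedBall (hC : IsCompact C) (R : ℝ) :
    Measurable fun θ₀ : C => Metric.diam (C ∩ Metric.closedBall (θ₀ : EuclideanSpace ℝ (Fin p)) R)
    := by
  refine measurable_of_Ici fun c => ?_
  rcases le_or_gt c 0 with hc | hc
  · convert MeasurableSet.univ
    exact Set.eq_univ_of_forall fun θ => hc.trans Metric.diam_nonneg
  have : CompactSpace C := isCompact_iff_compactSpace.1 hC
  set T : Set (C × (C × C)) :=
    {q | dist (q.2.1 : EuclideanSpace ℝ (Fin p)) q.1 ≤ R ∧
      dist (q.2.2 : EuclideanSpace ℝ (Fin p)) q.1 ≤ R ∧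
      c ≤ dist (q.2.1 : EuclideanSpace ℝ (Fin p)) q.2.2} with hT
  have hTc : IsClosed T := by
    rw [hT, Set.ofPred_and, Set.ofPred_and]
    exact (isClosed_le (by fun_prop) (by fun_prop)).inter
        ((isClosed_le (by fun_prop) (by fun_prop)).inter (isClosed_le (by fun_prop) (by fun_prop)))
  convert (isClosedMap_fst_of_compactSpace T hTc).measurableSet
  ext θ
  constructor
  · intro h
    have h : c ≤ Metric.diam (C ∩ Metric.closedBall (θ : EuclideanSpace ℝ (Fin p)) R) := h
    set K := C ∩ Metric.closedBall (θ : EuclideanSpace ℝ (Fin p)) R with hK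
    have hKc : IsCompact K := hC.inter_right Metric.isClosed_closedBall
    have hKne : K.Nonempty := by
      by_contra hne
      rw [Set.not_nonempty_iff_eq_empty.1 hne, Metric.diam_empty] at h
      linarith
    obtain ⟨⟨x, y⟩, ⟨hx, hy⟩, hmax⟩ := (hKc.prod hKc).exists_isMaxOn (hKne.prod hKne)
      (f := fun q => dist q.1 q.2) (by fun_prop)
    refine ⟨(θ, (⟨x, hx.1⟩, ⟨y, hy.1⟩)), ⟨hx.2, hy.2, h.trans ?_⟩, rfl⟩
    exact Metric.diam_le_of_forall_dist_le dist_nonneg fun a ha b hb =>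
      isMaxOn_iff.1 hmax (a, b) ⟨ha, hb⟩
  · rintro ⟨⟨θ', x, y⟩, ⟨h1, h2, h3⟩, rfl⟩
    exact h3.trans (Metric.dist_le_diam_of_mem
      (hC.isBounded.subset Set.inter_subset_left) ⟨x.2, h1⟩ ⟨y.2, h2⟩)

/-- The unnormalized density is a jointly measurable function `G` of `(θ₀, θ)`; the normalizer and
the mass of `S` are then parameter integrals. The loss is cut off outside `C`, where nothing is
known about it. -/
theorem isComposable_expSampling (hC : IsBody C) (hlip : IsLipschitzLoss ℓ L C) :
    IsComposable (expSampling p n) ℓ L Δ ε C := by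
  intro D
  simp only [locSet_eq]
  set R := 12 * (L * p * Real.log n / (Δ * ε * n))
  have hCm := hC.measurableSet
  set φ := C.indicator (empLoss ℓ D) with hφ
  have hφm : Measurable φ := by
    classical
    rw [hφ, ← Set.piecewise_eq_indicator]
    exact (continuousOn_empLoss hlip D).measurable_piecewise continuousOn_const hCm
  set κ : C → ℝ := fun θ₀ => ε / 2 / (2 * L * Metric.diam
    (C ∩ Metric.closedBall (θ₀ : EuclideanSpace ℝ (Fin p)) R)) with hκ
  have hκm : Measurable κ :=
    measurable_const.div (measurable_const.mul (measurable_diam_inter_closedBall hC.2.1 R))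
  set T : Set (C × EuclideanSpace ℝ (Fin p)) :=
    {q | q.2 ∈ C ∩ Metric.closedBall (q.1 : EuclideanSpace ℝ (Fin p)) R} with hT
  have hTm : MeasurableSet T :=
    (measurable_snd hCm).inter (measurableSet_le (by fun_prop) measurable_const)
  have hGm : Measurable (T.indicator fun q => Real.exp (-κ q.1 * φ q.2)) :=
    (Real.measurable_exp.comp ((hκm.comp measurable_fst).neg.mul
      (hφm.comp measurable_snd))).indicator hTm
  set G := T.indicator fun q => Real.exp (-κ q.1 * φ q.2) with hG
  have hG1 : ∀ θ₀ : C, (C ∩ Metric.closedBall (θ₀ : EuclideanSpace ℝ (Fin p)) R).indicator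
      (fun θ => Real.exp (-κ θ₀ * empLoss ℓ D θ)) = fun θ => G (θ₀, θ) := by
    intro θ₀
    ext θ
    by_cases hθ : θ ∈ C ∩ Metric.closedBall (θ₀ : EuclideanSpace ℝ (Fin p)) R
    · have : (θ₀, θ) ∈ T := hθ
      rw [Set.indicator_of_mem hθ, hG, Set.indicator_of_mem this, hφ,
        Set.indicator_of_mem hθ.1]
    · have : (θ₀, θ) ∉ T := hθ
      rw [Set.indicator_of_notMem hθ, hG, Set.indicator_of_notMem this]
  have hZm : Measurable fun θ₀ : C => ∫ θ, G (θ₀, θ) :=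
    (StronglyMeasurable.integral_prod_right (f := fun (θ₀ : C) θ => G (θ₀, θ))
      hGm.stronglyMeasurable (ν := volume)).measurable
  have hKm : ∀ θ₀ : C, MeasurableSet
      (C ∩ Metric.closedBall (θ₀ : EuclideanSpace ℝ (Fin p)) R) := fun θ₀ =>
    hCm.inter Metric.isClosed_closedBall.measurableSet
  refine Measure.measurable_of_measurable_coe _ fun S hS => ?_
  have heq : ∀ θ₀ : C, expSampling p n X ℓ L (ε / 2)
      (C ∩ Metric.closedBall (θ₀ : EuclideanSpace ℝ (Fin p)) R) D S =
      ∫⁻ θ in S, ENNReal.ofReal (G (θ₀, θ) / ∫ θ', G (θ₀, θ')) := by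
    intro θ₀
    rw [expSampling, tilted_apply' _ _ hS, ← integral_indicator (hKm θ₀), hG1 θ₀,
      Measure.restrict_restrict hS, Set.inter_comm, ← Measure.restrict_restrict (hKm θ₀),
      ← lintegral_indicator (hKm θ₀)]
    refine lintegral_congr fun θ => ?_
    rw [← congrFun (hG1 θ₀) θ]
    by_cases hθ : θ ∈ C ∩ Metric.closedBall (θ₀ : EuclideanSpace ℝ (Fin p)) R
    · simp only [Set.indicator_of_mem hθ, hκ]
    · simp only [Set.indicator_of_notMem hθ, zero_div, ENNReal.ofReal_zero]
  simp only [heq]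
  exact Measurable.lintegral_prod_right'
    (f := fun q : C × EuclideanSpace ℝ (Fin p) => ENNReal.ofReal (G q / ∫ θ', G (q.1, θ')))
    (hGm.div (hZm.comp measurable_fst)).ennreal_ofReal

end ExponentialSampling


/-! ### Diameter of a convex set cut by a ball -/

section Diameter

variable {p : ℕ} {C : Set (EuclideanSpace ℝ (Fin p))} {r : ℝ} {θ : EuclideanSpace ℝ (Fin p)}

theorem diam_inter_closedBall_le (C : Set (EuclideanSpace ℝ (Fin p)))
    (θ : EuclideanSpace ℝ (Fin p)) (hr : 0 ≤ r) :
    Metric.diam (C ∩ Metric.closedBall θ r) ≤ 2 * r :=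
  (Metric.diam_mono Set.inter_subset_right Metric.isBounded_closedBall).trans
    (Metric.diam_closedBall hr)

/-- If `C` leaves the ball, the segment from `θ` to an outside point crosses the sphere inside `C`,
giving two points at distance `r`. -/
theorem min_le_diam_inter_closedBall (hconv : Convex ℝ C) (hb : Bornology.IsBounded C)
    (hr : 0 ≤ r) (hθ : θ ∈ C) :
    min (2 * r) (Metric.diam C) ≤ 2 * Metric.diam (C ∩ Metric.closedBall θ r) := by
  by_cases h : C ⊆ Metric.closedBall θ r
  · rw [Set.inter_eq_left.2 h]
    exact (min_le_right _ _).trans (by linarith [Metric.diam_nonneg (s := C)])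
  · obtain ⟨x, hx, hxr⟩ := Set.not_subset.1 h
    have hlt : r < ‖x - θ‖ := by simpa [dist_eq_norm] using hxr
    have hpos : 0 < ‖x - θ‖ := hr.trans_lt hlt
    have hy : θ + (r / ‖x - θ‖) • (x - θ) ∈ C :=
      hconv.add_smul_sub_mem hθ hx ⟨by positivity, (div_le_one hpos).2 hlt.le⟩
    have hdist : dist (θ + (r / ‖x - θ‖) • (x - θ)) θ = r := by
      rw [dist_eq_norm, add_sub_cancel_left, norm_smul, Real.norm_of_nonneg (by positivity),
        div_mul_cancel₀ _ hpos.ne']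
    have hle := Metric.dist_le_diam_of_mem (hb.subset Set.inter_subset_left)
      ⟨hy, Metric.mem_closedBall.2 hdist.le⟩ ⟨hθ, Metric.mem_closedBall_self hr⟩
    rw [hdist] at hle
    exact (min_le_left _ _).trans (by linarith)

end Diameter

/-! ### Risk of localization -/

section Risk

variable {p n : ℕ} {X : Type u} {C : Set (EuclideanSpace ℝ (Fin p))}
  {ℓ : EuclideanSpace ℝ (Fin p) → X → ℝ} {L Δ ε : ℝ}

theorem excessRiskLE_of_lintegral_le (hC : IsBody C) (hlip : IsLipschitzLoss ℓ L C)
    {D : Fin n → X} {μ : Measure (EuclideanSpace ℝ (Fin p))} [IsFiniteMeasure μ] (hμ : μ Cᶜ = 0)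
    {R : ℝ} (hR : 0 ≤ R)
    (h : ∫⁻ θ, ENNReal.ofReal (empLoss ℓ D θ - empLoss ℓ D (argminOn C (empLoss ℓ D))) ∂μ ≤
      ENNReal.ofReal R) : ExcessRiskLE ℓ C D μ R := by
  obtain ⟨-, hmin⟩ := argminOn_empLoss_spec hC.2.1 (hC.2.2.mono interior_subset) hlip D
  have hmem : ∀ᵐ θ ∂μ, θ ∈ C := hμ
  have hnonneg : 0 ≤ᵐ[μ] fun θ => empLoss ℓ D θ - empLoss ℓ D (argminOn C (empLoss ℓ D)) :=
    hmem.mono fun θ hθ => sub_nonneg.2 (hmin hθ)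
  have hmeas : AEStronglyMeasurable
      (fun θ => empLoss ℓ D θ - empLoss ℓ D (argminOn C (empLoss ℓ D))) μ := by
    rw [← Measure.restrict_eq_self_of_ae_mem hmem]
    exact ((continuousOn_empLoss hlip D).sub continuousOn_const).aestronglyMeasurable
      hC.measurableSet
  refine ⟨⟨hmeas, (hasFiniteIntegral_iff_ofReal hnonneg).2 (h.trans_lt ENNReal.ofReal_lt_top)⟩, ?_⟩
  rw [integral_eq_lintegral_of_nonneg_ae hnonneg hmeas]
  exact ENNReal.toReal_le_of_le_ofReal hR h

theorem ExcessRiskLE.nonneg_and_lintegral_le (hC : IsBody C) (hlip : IsLipschitzLoss ℓ L C)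
    {D : Fin n → X} {μ : Measure (EuclideanSpace ℝ (Fin p))} (hμ : μ Cᶜ = 0)
    {R : ℝ} (h : ExcessRiskLE ℓ C D μ R) : 0 ≤ R ∧
    ∫⁻ θ, ENNReal.ofReal (empLoss ℓ D θ - empLoss ℓ D (argminOn C (empLoss ℓ D))) ∂μ ≤
      ENNReal.ofReal R := by
  obtain ⟨-, hmin⟩ := argminOn_empLoss_spec hC.2.1 (hC.2.2.mono interior_subset) hlip D
  have hmem : ∀ᵐ θ ∂μ, θ ∈ C := hμ
  have hnonneg : 0 ≤ᵐ[μ] fun θ => empLoss ℓ D θ - empLoss ℓ D (argminOn C (empLoss ℓ D)) :=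
    hmem.mono fun θ hθ => sub_nonneg.2 (hmin hθ)
  refine ⟨(integral_nonneg_of_ae hnonneg).trans h.2, ?_⟩
  rw [← ofReal_integral_eq_lintegral_ofReal h.1 hnonneg]
  exact ENNReal.ofReal_le_ofReal h.2

theorem exp_one_sub_three_mul_log (hn : 2 ≤ n) :
    Real.exp (1 - 3 * Real.log n) = Real.exp 1 / n ^ 3 := by
  have hn' : (0 : ℝ) < n := by positivity
  rw [Real.exp_sub, ← Real.log_rpow hn', Real.exp_log (by positivity)]
  norm_cast

/-- Makes `x = 3 log n` admissible in the tail bound for every `n ≥ 2`, as `3 log 2 > 2`. -/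
theorem two_le_three_mul_log (hn : 2 ≤ n) : 2 ≤ 3 * Real.log n := by
  have : Real.log 2 ≤ Real.log n := Real.log_le_log two_pos (by exact_mod_cast hn)
  linarith [Real.log_two_gt_d9]

theorem lintegral_perturbed_tail_le (hp : 1 ≤ p) (hn : 2 ≤ n) (hL : 0 < L) (hΔ : 0 < Δ)
    (hε : 0 < ε) {r : ℝ} (hr : r = 12 * (L * p * Real.log n / (Δ * ε * n))) :
    ∫⁻ b in {b : EuclideanSpace ℝ (Fin p) | r < ‖b‖}, ENNReal.ofReal ‖b‖
      ∂(noise p (n * Δ * (ε / 2) / (2 * L))) ≤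
      ENNReal.ofReal (2 * r * (Real.exp 1 / n ^ 3)) := by
  have hn' : (0 : ℝ) < n := by positivity
  have h := lintegral_norm_noise_tail_le (p := p) (r := n * Δ * (ε / 2) / (2 * L)) hp
    (by positivity) (two_le_three_mul_log hn)
  have hr' : p * (3 * Real.log n) / (n * Δ * (ε / 2) / (2 * L)) = r := by
    rw [hr]
    field_simp
    ring
  rwa [hr', exp_one_sub_three_mul_log hn] at h

/-- The risk of localization is at most the risk of the second step on sets that contain the
minimizer, plus the contribution of the event that the minimizer is cut off. -/
theorem excessRiskLE_localization {A : LipAlgorithm.{u} p n} (hC : IsBody C) (hp : 1 ≤ p)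
    (hn : 2 ≤ n) (hL : 0 < L) (hΔ : 0 < Δ) (hε : 0 < ε) (hlip : IsLipschitzLoss ℓ L C)
    (hcomp : IsComposable A ℓ L Δ ε C) (hloc : IsPrivateSolver (localization A Δ) ℓ L ε C)
    (hA : ∀ C' ⊆ C, IsBody C' → ∀ D, IsProbabilityMeasure (A X ℓ L (ε / 2) C' D) ∧
      A X ℓ L (ε / 2) C' D C'ᶜ = 0) (D : Fin n → X) {R : ℝ} (hR : 0 ≤ R)
    (hrisk : ∀ θ₀ ∈ C, argminOn C (empLoss ℓ D) ∈ locSet n L Δ ε C θ₀ →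
      ∫⁻ θ, ENNReal.ofReal (empLoss ℓ D θ - empLoss ℓ D (argminOn C (empLoss ℓ D)))
        ∂(A X ℓ L (ε / 2) (locSet n L Δ ε C θ₀) D) ≤ ENNReal.ofReal R) :
    ExcessRiskLE ℓ C D (localization A Δ X ℓ L ε C D)
      (R + 2 * Real.exp 1 * L * min (2 * (12 * (L * p * Real.log n / (Δ * ε * n))))
        (Metric.diam C) / n ^ 2) := by
  have hne : C.Nonempty := hC.2.2.mono interior_subset
  have hn' : (0 : ℝ) < n := by positivity
  obtain ⟨hprob, hsupp⟩ := hloc.1 D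
  obtain ⟨hz, hmin⟩ := argminOn_empLoss_spec hC.2.1 hne hlip D
  set z := argminOn C (empLoss ℓ D) with hzdef
  have hrpos := radius_pos hp hn hL hΔ hε
  set r := 12 * (L * p * Real.log n / (Δ * ε * n)) with hr
  set d := Metric.diam C with hd
  have hd0 : 0 ≤ d := Metric.diam_nonneg
  refine excessRiskLE_of_lintegral_le hC hlip hsupp (by positivity) ?_
  -- When `‖b‖ > r`, the output is within `r + ‖b‖ ≤ 2‖b‖` of the minimizer, and also within `d ≤ (d
  -- / r) * ‖b‖`. Keeping the minimum lets the failure term be compared with the diameter of a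
  -- localized set in the generic case.
  set c := n * L * min 2 (d / r) with hc
  have hc0 : 0 ≤ c := by positivity
  set g := C.indicator fun θ => ENNReal.ofReal (empLoss ℓ D θ - empLoss ℓ D z) with hg
  have hgm : Measurable g := by
    have : Measurable (C.indicator fun θ => empLoss ℓ D θ - empLoss ℓ D z) := by
      classical
      rw [← Set.piecewise_eq_indicator]
      exact ((continuousOn_empLoss hlip D).sub continuousOn_const).measurable_piecewise
        continuousOn_const hC.measurableSet
    convert this.ennreal_ofReal using 1
    ext θ
    by_cases hθ : θ ∈ C <;> simp [hg, hθ]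
  have hgle : ∀ θ, g θ ≤ ENNReal.ofReal (empLoss ℓ D θ - empLoss ℓ D z) := fun θ =>
    Set.indicator_le_self' (fun _ _ => zero_le) θ
  have hgeq : ∫⁻ θ, ENNReal.ofReal (empLoss ℓ D θ - empLoss ℓ D z)
      ∂(localization A Δ X ℓ L ε C D) = ∫⁻ θ, g θ ∂(localization A Δ X ℓ L ε C D) := by
    have hmem : ∀ᵐ θ ∂(localization A Δ X ℓ L ε C D), θ ∈ C := hsupp
    exact lintegral_congr_ae (hmem.mono fun θ hθ => by rw [hg, Set.indicator_of_mem hθ])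
  have hpt : ∀ b : EuclideanSpace ℝ (Fin p),
      ∫⁻ θ, g θ ∂(A X ℓ L (ε / 2) (locSet n L Δ ε C (proj C (z + b))) D) ≤
        ENNReal.ofReal R + {b : EuclideanSpace ℝ (Fin p) | r < ‖b‖}.indicator
          (fun b => ENNReal.ofReal c * ENNReal.ofReal ‖b‖) b := by
    intro b
    have hθ₀ := proj_mem hC.2.1 hne (z + b)
    have hclose : ‖z - proj C (z + b)‖ ≤ ‖b‖ := by
      have := norm_proj_sub_proj_le hC.2.1 hC.1 hne z (z + b)
      rwa [proj_of_mem hC.2.1 hz, sub_add_cancel_left, norm_neg] at this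
    set θ₀ := proj C (z + b)
    rcases le_or_gt ‖b‖ r with hb | hb
    · refine (lintegral_mono hgle).trans ((hrisk θ₀ hθ₀ ?_).trans le_self_add)
      rw [locSet_eq]
      exact ⟨hz, by simpa [dist_eq_norm] using hclose.trans hb⟩
    · obtain ⟨hAprob, hAsupp⟩ := hA _ (locSet_subset θ₀)
        (isBody_locSet (n := n) hC hp hn hL hΔ hε hθ₀) D
      have hmem : ∀ᵐ θ ∂(A X ℓ L (ε / 2) (locSet n L Δ ε C θ₀) D),
        θ ∈ locSet n L Δ ε C θ₀ := hAsupp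
      have hle : ∀ᵐ θ ∂(A X ℓ L (ε / 2) (locSet n L Δ ε C θ₀) D),
          g θ ≤ ENNReal.ofReal (c * ‖b‖) := by
        filter_upwards [hmem] with θ hθ
        refine (hgle θ).trans (ENNReal.ofReal_le_ofReal ?_)
        rw [locSet_eq, ← hr] at hθ
        have h1 := (abs_le.1 (abs_empLoss_sub_le hlip D hθ.1 hz)).2
        have h2 : ‖θ - θ₀‖ ≤ r := by simpa [dist_eq_norm] using hθ.2
        have h3 : ‖θ - z‖ ≤ 2 * ‖b‖ := by
          have := norm_sub_le_norm_sub_add_norm_sub θ θ₀ z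
          rw [norm_sub_rev θ₀ z] at this
          linarith
        have h4 : ‖θ - z‖ ≤ d / r * ‖b‖ := by
          have h5 : ‖θ - z‖ ≤ d := by
            rw [← dist_eq_norm]
            exact Metric.dist_le_diam_of_mem hC.2.1.isBounded hθ.1 hz
          rw [div_mul_eq_mul_div, le_div_iff₀ hrpos]
          exact mul_le_mul h5 hb.le hrpos.le hd0
        calc empLoss ℓ D θ - empLoss ℓ D z ≤ n * L * ‖θ - z‖ := h1
          _ ≤ n * L * (min 2 (d / r) * ‖b‖) := by
              gcongr
              rw [min_mul_of_nonneg _ _ (norm_nonneg b)]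
              exact le_min h3 h4
          _ = c * ‖b‖ := by rw [hc]; ring
      refine (lintegral_mono_ae hle).trans ?_
      rw [lintegral_const, measure_univ, mul_one, ENNReal.ofReal_mul hc0,
        Set.indicator_of_mem (by exact hb)]
      exact le_add_self
  have hnoise := isProbabilityMeasure_noise (p := p) (r := n * Δ * (ε / 2) / (2 * L)) hp
    (by positivity)
  have hball : MeasurableSet {b : EuclideanSpace ℝ (Fin p) | r < ‖b‖} :=
    measurableSet_lt measurable_const measurable_norm
  rw [hgeq, localization, Measure.lintegral_bind (hcomp.aemeasurable hC D) hgm.aemeasurable]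
  refine (lintegral_map_le _ _).trans ((lintegral_mono hpt).trans ?_)
  rw [lintegral_add_left measurable_const, lintegral_const, measure_univ, mul_one,
    lintegral_indicator hball, lintegral_const_mul' _ _ ENNReal.ofReal_ne_top]
  calc ENNReal.ofReal R + ENNReal.ofReal c *
        ∫⁻ b in {b : EuclideanSpace ℝ (Fin p) | r < ‖b‖}, ENNReal.ofReal ‖b‖
          ∂(noise p (n * Δ * (ε / 2) / (2 * L)))
      ≤ ENNReal.ofReal R + ENNReal.ofReal c *
          ENNReal.ofReal (2 * r * (Real.exp 1 / n ^ 3)) := by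
        gcongr
        exact lintegral_perturbed_tail_le hp hn hL hΔ hε hr
    _ = _ := by
        rw [← ENNReal.ofReal_mul hc0, ← ENNReal.ofReal_add hR (by positivity)]
        congr 2
        have : min (2 * r) d = min 2 (d / r) * r := by
          rw [min_mul_of_nonneg _ _ hrpos.le, div_mul_cancel₀ _ hrpos.ne']
        rw [hc, this]
        field_simp

/-- Risk of localization with a sampler dominated by exponential sampling. -/
theorem excessRiskLE_localization_of_le_expSampling {A : LipAlgorithm.{u} p n} (hC : IsBody C)
    (hp : 1 ≤ p) (hn : 2 ≤ n) (hL : 0 < L) (hΔ : 0 < Δ) (hε : 0 < ε) {ε' B c : ℝ} (hε' : 0 < ε')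
    (hc : 0 ≤ c) (hεε' : ε ≤ 6 * ε') (hB : ε ≤ B * (p * n ^ 2)) (hlip : IsLipschitzLoss ℓ L C)
    (hsc : ∀ d, StrongConvexOn C Δ fun θ => ℓ θ d)
    (hcomp : IsComposable A ℓ L Δ ε C) (hloc : IsPrivateSolver (localization A Δ) ℓ L ε C)
    (hA : ∀ C' ⊆ C, IsBody C' → ∀ D, IsProbabilityMeasure (A X ℓ L (ε / 2) C' D) ∧
      A X ℓ L (ε / 2) C' D C'ᶜ = 0)
    (hle : ∀ C' ⊆ C, IsBody C' → ∀ D,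
      A X ℓ L (ε / 2) C' D ≤ ENNReal.ofReal c • expSampling p n X ℓ L ε' C' D) (D : Fin n → X) :
    ExcessRiskLE ℓ C D (localization A Δ X ℓ L ε C D)
      ((576 * c + 48 * Real.exp 1 * B) *
        (p ^ 2 * L ^ 2 / (n * Δ * ε ^ 2) * Real.log n)) := by
  have hn' : (0 : ℝ) < n := by positivity
  have hp' : (0 : ℝ) < p := by positivity
  have hrpos := radius_pos hp hn hL hΔ hε
  have hlog : 0 < Real.log n := Real.log_pos (by exact_mod_cast hn)
  obtain ⟨hz, hmin⟩ := argminOn_empLoss_spec hC.2.1 (hC.2.2.mono interior_subset) hlip D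
  set r := 12 * (L * p * Real.log n / (Δ * ε * n)) with hr
  set T := (p : ℝ) ^ 2 * L ^ 2 / (n * Δ * ε ^ 2) * Real.log n with hT
  have hT0 : 0 ≤ T := by positivity
  -- Converts `r` into the target rate `T`; the spare factor `ε` is paid by `ε'` in the sampling
  -- term and by `B * (p * n ^ 2)` in the failure term.
  have hrT : p * L * r = 12 * T * ε := by
    rw [hr, hT]
    field_simp
  have key := excessRiskLE_localization hC hp hn hL hΔ hε hlip hcomp hloc hA D
    (R := 576 * c * T) (by positivity) (fun θ₀ hθ₀ hmem => ?_)
  · refine ⟨key.1, key.2.trans ?_⟩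
    rw [← hr, add_mul]
    refine add_le_add le_rfl ?_
    calc 2 * Real.exp 1 * L * min (2 * r) (Metric.diam C) / n ^ 2
        ≤ 2 * Real.exp 1 * L * (2 * r) / n ^ 2 := by
          gcongr
          exact min_le_left _ _
      _ = 4 * Real.exp 1 * (p * L * r) / (p * n ^ 2) := by field_simp; ring
      _ = 48 * Real.exp 1 * T * (ε / (p * n ^ 2)) := by rw [hrT]; ring
      _ ≤ 48 * Real.exp 1 * T * B := by
          gcongr
          exact (div_le_iff₀ (by positivity)).2 hB
      _ = 48 * Real.exp 1 * B * T := by ring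
  · have hbody := isBody_locSet (n := n) hC hp hn hL hΔ hε hθ₀
    have hsub : locSet n L Δ ε C θ₀ ⊆ C := locSet_subset θ₀
    have hexp := lintegral_expSampling_sub_le hbody hL hε' (hlip.mono hsub)
      (fun d => (convexOn_of_strongConvexOn hΔ.le (hsc d)).subset hsub hbody.1) D hmem
      (hmin.on_subset hsub)
    have hdiam : Metric.diam (locSet n L Δ ε C θ₀) ≤ 2 * r := by
      rw [locSet_eq]
      exact diam_inter_closedBall_le C θ₀ hrpos.le
    refine (lintegral_mono' (hle _ hsub hbody D) le_rfl).trans ?_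
    rw [lintegral_smul_measure, smul_eq_mul]
    refine (mul_le_mul_right hexp _).trans ?_
    rw [← ENNReal.ofReal_mul hc]
    refine ENNReal.ofReal_le_ofReal ?_
    -- `576 = 4 * 2 * 12 * 6`: sampling risk, diameter `2r`, the radius, and `ε ≤ 6 ε'`.
    have hbound : 4 * p * L * Metric.diam (locSet n L Δ ε C θ₀) / ε' ≤ 576 * T := by
      rw [div_le_iff₀ hε']
      have h1 : 4 * p * L * Metric.diam (locSet n L Δ ε C θ₀) ≤ 4 * p * L * (2 * r) := by
        gcongr
      have h2 : T * ε ≤ T * (6 * ε') := by gcongr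
      linarith
    calc c * (4 * p * L * Metric.diam (locSet n L Δ ε C θ₀) / ε') ≤ c * (576 * T) := by gcongr
      _ = 576 * c * T := by ring

end Risk

/-! ### A lower bound on the risk of private algorithms -/

section LowerBound

variable {p n : ℕ} {C : Set (EuclideanSpace ℝ (Fin p))} {L ε : ℝ}

/-- The data set whose first entry is `s` and whose other entries are `0`. -/
def spikeData (n : ℕ) [NeZero n] (s : SignType) : Fin n → ULift.{u} SignType :=
  fun i => if i = 0 then ⟨s⟩ else ⟨0⟩

/-- The linear losses `θ ↦ s L ⟨v, θ⟩` for `s = -1, 0, 1`. -/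
noncomputable def signLoss (L : ℝ) (v θ : EuclideanSpace ℝ (Fin p)) (s : ULift.{u} SignType) : ℝ :=
  (s.down : ℝ) * (L * inner ℝ v θ)

theorem empLoss_spikeData [NeZero n] (L : ℝ) (v θ : EuclideanSpace ℝ (Fin p)) (s : SignType) :
    empLoss (signLoss.{u} L v) (spikeData n s) θ = (s : ℝ) * (L * inner ℝ v θ) := by
  rw [empLoss, Finset.sum_eq_single (0 : Fin n)]
  · simp [signLoss, spikeData]
  · intro i _ hi
    simp [signLoss, spikeData, hi]
  · simp

theorem isLipschitzLoss_signLoss (hL : 0 ≤ L) {v : EuclideanSpace ℝ (Fin p)} (hv : ‖v‖ ≤ 1) :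
    IsLipschitzLoss (signLoss.{u} L v) L C := by
  rintro ⟨s⟩ x - y -
  have h1 : |(s : ℝ)| ≤ 1 := by cases s <;> simp
  have h2 : |inner ℝ v (x - y)| ≤ ‖x - y‖ :=
    (abs_real_inner_le_norm _ _).trans (mul_le_of_le_one_left (norm_nonneg _) hv)
  have h3 : signLoss L v x ⟨s⟩ - signLoss L v y ⟨s⟩ = s * (L * inner ℝ v (x - y)) := by
    simp only [signLoss, inner_sub_right]
    ring
  rw [h3, abs_mul, abs_mul, abs_of_nonneg hL]
  calc |(s : ℝ)| * (L * |inner ℝ v (x - y)|) ≤ 1 * (L * ‖x - y‖) := by gcongr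
    _ = _ := one_mul _

theorem convexOn_signLoss (hC : Convex ℝ C) (L : ℝ) (v : EuclideanSpace ℝ (Fin p))
    (s : ULift.{u} SignType) : ConvexOn ℝ C fun θ => signLoss L v θ s := by
  refine ⟨hC, fun x _ y _ a b _ _ _ => le_of_eq ?_⟩
  simp only [signLoss, inner_add_right, inner_smul_right, smul_eq_mul]
  ring

/-- A differentially private algorithm cannot beat the risk `L ‖C‖₂ / (1 + exp ε)` on all convex
`L`-Lipschitz losses. -/
theorem mul_diam_le_of_isPrivateSolver {A : LipAlgorithm.{u} p n} {R : ℝ} (hC : IsBody C)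
    (hn : 1 ≤ n) (hL : 0 ≤ L)
    (h : ∀ (X : Type u) (ℓ : EuclideanSpace ℝ (Fin p) → X → ℝ),
      (∀ d, ConvexOn ℝ C fun θ => ℓ θ d) → IsLipschitzLoss ℓ L C →
      IsPrivateSolver A ℓ L ε C ∧ ∀ D : Fin n → X, ExcessRiskLE ℓ C D (A X ℓ L ε C D) R) :
    0 ≤ R ∧ L * Metric.diam C ≤ (1 + Real.exp ε) * R := by
  have : NeZero n := ⟨by omega⟩
  have hne : C.Nonempty := hC.2.2.mono interior_subset
  obtain ⟨⟨x, y⟩, ⟨hx, hy⟩, hmax⟩ := (hC.2.1.prod hC.2.1).exists_isMaxOn (hne.prod hne)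
    (f := fun q => dist q.1 q.2) (by fun_prop)
  have hdiam : Metric.diam C ≤ ‖x - y‖ := by
    rw [← dist_eq_norm]
    exact Metric.diam_le_of_forall_dist_le dist_nonneg fun a ha b hb =>
      isMaxOn_iff.1 hmax (a, b) ⟨ha, hb⟩
  set v := ‖x - y‖⁻¹ • (x - y) with hv
  have hv1 : ‖v‖ ≤ 1 := by
    rw [hv, norm_smul, norm_inv, norm_norm]
    exact inv_mul_le_one
  have hvxy : inner ℝ v x - inner ℝ v y = ‖x - y‖ := by
    rw [← inner_sub_right, hv, real_inner_smul_left, real_inner_self_eq_norm_mul_norm]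
    rcases eq_or_ne ‖x - y‖ 0 with h0 | h0
    · simp [h0]
    · field_simp
  have hlip : IsLipschitzLoss (signLoss.{u} L v) L C := isLipschitzLoss_signLoss hL hv1
  obtain ⟨⟨hprob, hdp⟩, hrisk⟩ := h _ _ (convexOn_signLoss hC.1 L v) hlip
  have hbound := fun s : SignType =>
    (hrisk (spikeData n s)).nonneg_and_lintegral_le hC hlip (hprob _).2
  have hargmin := fun s : SignType =>
    argminOn_empLoss_spec hC.2.1 hne hlip (spikeData n s)
  simp only [empLoss_spikeData] at hbound
  have hR : 0 ≤ R := (hbound 0).1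
  refine ⟨hR, ?_⟩
  have hup := (hbound 1).2
  have hdown := (hbound (-1)).2
  have hminup := isMinOn_iff.1 (hargmin 1).2 y hy
  have hmindown := isMinOn_iff.1 (hargmin (-1)).2 x hx
  simp only [empLoss_spikeData] at hminup hmindown
  set a := argminOn C (empLoss (signLoss.{u} L v) (spikeData n 1))
  set b := argminOn C (empLoss (signLoss.{u} L v) (spikeData n (-1)))
  simp only [SignType.coe_one, SignType.coe_neg_one, one_mul, neg_mul] at *
  have hneigh : Neighbors (spikeData.{u} n (-1)) (spikeData n 1) :=
    ⟨0, fun j hj => by simp [spikeData, hj]⟩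
  set μ := A (ULift.{u} SignType) (signLoss L v) L ε C (spikeData n (-1))
  set ν := A (ULift.{u} SignType) (signLoss L v) L ε C (spikeData n 1)
  have hle : μ ≤ ENNReal.ofReal (Real.exp ε) • ν :=
    Measure.le_intro fun S hS _ => by simpa using hdp _ _ hneigh S hS
  have hμ : IsProbabilityMeasure μ := (hprob _).1
  -- No `θ` is good for both signs: the two excess losses add up to at least `L` times the diameter.
  -- Privacy then lets both be integrated against `μ`, at cost `exp ε` for the first.
  have h1 : ∀ θ, ENNReal.ofReal (L * Metric.diam C) ≤
      ENNReal.ofReal (L * inner ℝ v θ - L * inner ℝ v a) +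
        ENNReal.ofReal (-(L * inner ℝ v θ) - -(L * inner ℝ v b)) := by
    intro θ
    refine (ENNReal.ofReal_le_ofReal ?_).trans ENNReal.ofReal_add_le
    have : L * Metric.diam C ≤ L * (inner ℝ v x - inner ℝ v y) := by
      rw [hvxy]
      gcongr
    linarith
  have h2 : ∫⁻ θ, ENNReal.ofReal (L * inner ℝ v θ - L * inner ℝ v a) ∂μ ≤
      ENNReal.ofReal (Real.exp ε) * ENNReal.ofReal R := by
    refine (lintegral_mono' hle le_rfl).trans ?_
    rw [lintegral_smul_measure, smul_eq_mul]
    gcongr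
  have h3 : ENNReal.ofReal (L * Metric.diam C) ≤ ENNReal.ofReal ((1 + Real.exp ε) * R) := by
    calc ENNReal.ofReal (L * Metric.diam C)
        = ∫⁻ _, ENNReal.ofReal (L * Metric.diam C) ∂μ := by simp
      _ ≤ _ := lintegral_mono h1
      _ = _ := lintegral_add_left (by fun_prop) _
      _ ≤ ENNReal.ofReal (Real.exp ε) * ENNReal.ofReal R + ENNReal.ofReal R := add_le_add h2 hdown
      _ = _ := by
        rw [← ENNReal.ofReal_mul (Real.exp_pos _).le, ← ENNReal.ofReal_add (by positivity) hR]
        congr 1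
        ring
  exact (ENNReal.ofReal_le_ofReal_iff (by positivity)).1 h3

end LowerBound

/-! ### Generic subroutines -/

section Generic

variable {p n : ℕ} {X : Type u} {C : Set (EuclideanSpace ℝ (Fin p))}
  {ℓ : EuclideanSpace ℝ (Fin p) → X → ℝ} {L Δ ε : ℝ}

theorem excessRiskLE_localization_of_generic {A : LipAlgorithm.{u} p n} {G : ℝ → ℝ} {B : ℝ}
    (hC : IsBody C) (hp : 1 ≤ p) (hn : 2 ≤ n) (hL : 0 < L) (hΔ : 0 < Δ) (hε : 0 < ε)
    (hB : ε ≤ B) (hlip : IsLipschitzLoss ℓ L C) (hsc : ∀ d, StrongConvexOn C Δ fun θ => ℓ θ d)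
    (hcomp : IsComposable A ℓ L Δ ε C) (hG : MonotoneOn G (Set.Ici 0))
    (hA : ∀ (X' : Type u) (ℓ' : EuclideanSpace ℝ (Fin p) → X' → ℝ), ∀ C' ⊆ C,
      IsBody C' → (∀ d, ConvexOn ℝ C' fun θ => ℓ' θ d) → IsLipschitzLoss ℓ' L C' →
      IsPrivateSolver A ℓ' L (ε / 2) C' ∧
      ∀ D : Fin n → X', ExcessRiskLE ℓ' C' D (A X' ℓ' L (ε / 2) C' D) (G (Metric.diam C')))
    (D : Fin n → X) :
    ExcessRiskLE ℓ C D (localization A Δ X ℓ L ε C D)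
      ((1 + 4 * Real.exp 1 * (1 + Real.exp (B / 2))) *
        G (24 * (L * p * Real.log n / (Δ * ε * n)))) := by
  have hne : C.Nonempty := hC.2.2.mono interior_subset
  have hrpos := radius_pos hp hn hL hΔ hε
  obtain ⟨hz, hmin⟩ := argminOn_empLoss_spec hC.2.1 hne hlip D
  have hsolver : ∀ C' ⊆ C, IsBody C' → IsPrivateSolver A ℓ L (ε / 2) C' := fun C' hC' hbody =>
    (hA X ℓ C' hC' hbody (fun d => (convexOn_of_strongConvexOn hΔ.le (hsc d)).subset hC' hbody.1)
      (hlip.mono hC')).1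
  have hloc := isPrivateSolver_localization hC hp hn hL hΔ hε hlip hsc hcomp hsolver
  have hr24 : 24 * (L * p * Real.log n / (Δ * ε * n)) =
      2 * (12 * (L * p * Real.log n / (Δ * ε * n))) := by ring
  rw [hr24]
  set r := 12 * (L * p * Real.log n / (Δ * ε * n)) with hr
  have hdiam : ∀ θ₀, Metric.diam (locSet n L Δ ε C θ₀) ≤ 2 * r := fun θ₀ => by
    rw [locSet_eq]
    exact diam_inter_closedBall_le C θ₀ hrpos.le
  have hmono : ∀ θ₀, G (Metric.diam (locSet n L Δ ε C θ₀)) ≤ G (2 * r) := fun θ₀ =>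
    hG Metric.diam_nonneg (show (0 : ℝ) ≤ 2 * r by positivity) (hdiam θ₀)
  have hbodyz := isBody_locSet (n := n) hC hp hn hL hΔ hε hz
  -- Apply the lower bound on the localized set centred at the minimizer: its diameter is at least
  -- half of `min (2 * r) (diam C)`, so `G` dominates the failure term.
  obtain ⟨hG0, hlower⟩ := mul_diam_le_of_isPrivateSolver hbodyz (by omega) hL.le
    (fun X' ℓ' => hA X' ℓ' _ (locSet_subset _) hbodyz)
  have hG2 := hG0.trans (hmono _)
  have key := excessRiskLE_localization hC hp hn hL hΔ hε hlip hcomp hloc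
    (fun C' hC' hbody => (hsolver C' hC' hbody).1) D hG2 (fun θ₀ hθ₀ hmem => ?_)
  · refine ⟨key.1, key.2.trans ?_⟩
    rw [← hr, add_mul, one_mul]
    refine add_le_add le_rfl ?_
    have h1 : min (2 * r) (Metric.diam C) ≤
        2 * Metric.diam (locSet n L Δ ε C (argminOn C (empLoss ℓ D))) := by
      rw [locSet_eq]
      exact min_le_diam_inter_closedBall hC.1 hC.2.1.isBounded hrpos.le hz
    have h2 : (1 : ℝ) ≤ n ^ 2 := one_le_pow₀ (by exact_mod_cast (by omega : 1 ≤ n))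
    calc 2 * Real.exp 1 * L * min (2 * r) (Metric.diam C) / n ^ 2
        ≤ 2 * Real.exp 1 * L * min (2 * r) (Metric.diam C) :=
          div_le_self (mul_nonneg (by positivity) (le_min (by positivity) Metric.diam_nonneg)) h2
      _ ≤ 2 * Real.exp 1 * L *
          (2 * Metric.diam (locSet n L Δ ε C (argminOn C (empLoss ℓ D)))) := by gcongr
      _ = 4 * Real.exp 1 *
          (L * Metric.diam (locSet n L Δ ε C (argminOn C (empLoss ℓ D)))) := by ring
      _ ≤ 4 * Real.exp 1 * ((1 + Real.exp (ε / 2)) *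
          G (Metric.diam (locSet n L Δ ε C (argminOn C (empLoss ℓ D))))) := by gcongr
      _ ≤ 4 * Real.exp 1 * ((1 + Real.exp (B / 2)) * G (2 * r)) := by
          gcongr
          exact hmono _
      _ = _ := by ring
  · have hsub : locSet n L Δ ε C θ₀ ⊆ C := locSet_subset θ₀
    have hbody := isBody_locSet (n := n) hC hp hn hL hΔ hε hθ₀
    obtain ⟨hsol, hrisk⟩ := hA X ℓ _ hsub hbody
      (fun d => (convexOn_of_strongConvexOn hΔ.le (hsc d)).subset hsub hbody.1) (hlip.mono hsub)
    have h1 := ((hrisk D).nonneg_and_lintegral_le hbody (hlip.mono hsub) (hsol.1 D).2).2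
    obtain ⟨-, hmin'⟩ := argminOn_empLoss_spec hbody.2.1 (hbody.2.2.mono interior_subset)
      (hlip.mono hsub) D
    -- The hypothesis measures excess against the minimizer over `C₀`; its loss is at most that of
    -- the minimizer over `C`, which lies in `C₀`.
    have h2 := isMinOn_iff.1 hmin' _ hmem
    refine (lintegral_mono fun θ => ENNReal.ofReal_le_ofReal ?_).trans
      (h1.trans (ENNReal.ofReal_le_ofReal (hmono θ₀)))
    linarith

end Generic

/-! ### Approximate exponential sampling -/

section Approximate

variable {Ω : Type*} [MeasurableSpace Ω] {n : ℕ} {X : Type u}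

/-- Pass from `M` to `N`, change the data set, and pass back. With all three costs equal to `ε / 6`
this spends the `ε / 2` of the second step. -/
theorem isDP_of_mulDistLE {t ε : ℝ} {M N : (Fin n → X) → Measure Ω} (hN : IsDP ε N)
    (h : ∀ D, MulDistLE t (M D) (N D)) : IsDP (t + ε + t) M := by
  intro D D' hD S hS
  rw [Real.exp_add, Real.exp_add, ENNReal.ofReal_mul (by positivity),
    ENNReal.ofReal_mul (by positivity), mul_assoc, mul_assoc]
  refine ((h D S hS).1).trans ?_
  gcongr
  refine (hN D D' hD S hS).trans ?_
  gcongr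
  exact (h D' S hS).2

end Approximate


theorem localization_of_mulDistLE {p n : ℕ} {X : Type u} {C : Set (EuclideanSpace ℝ (Fin p))}
    {ℓ : EuclideanSpace ℝ (Fin p) → X → ℝ} {L Δ ε B : ℝ} {A : LipAlgorithm.{u} p n}
    (hC : IsBody C) (hp : 1 ≤ p)
    (hn : 2 ≤ n) (hL : 0 < L) (hΔ : 0 < Δ) (hε : 0 < ε) (hlip : IsLipschitzLoss ℓ L C)
    (hsc : ∀ d, StrongConvexOn C Δ fun θ => ℓ θ d) (hcomp : IsComposable A ℓ L Δ ε C)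
    (hA : ∀ C' ⊆ C, IsBody C' → ∀ D, IsProbabilityMeasure (A X ℓ L (ε / 2) C' D) ∧
      MulDistLE (ε / 2 / 3) (A X ℓ L (ε / 2) C' D) (expSampling p n X ℓ L (ε / 2 / 3) C' D)) :
    IsPrivateSolver (localization A Δ) ℓ L ε C ∧
      (ε ≤ B → ∀ D : Fin n → X, ExcessRiskLE ℓ C D (localization A Δ X ℓ L ε C D)
        ((576 * Real.exp (B / 6) + 48 * Real.exp 1 * B) *
          (p ^ 2 * L ^ 2 / (n * Δ * ε ^ 2) * Real.log n))) := by
  have hsolver : ∀ C' ⊆ C, IsBody C' → IsPrivateSolver A ℓ L (ε / 2) C' := by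
    intro C' hC' hbody
    have hexp := isPrivateSolver_expSampling (n := n) (ε := ε / 2 / 3) hbody hL (by positivity)
      (hlip.mono hC')
    refine ⟨fun D => ⟨(hA C' hC' hbody D).1, ?_⟩, ?_⟩
    · have h := ((hA C' hC' hbody D).2 C'ᶜ hbody.measurableSet.compl).1
      rw [(hexp.1 D).2, mul_zero] at h
      exact le_antisymm h zero_le
    · have h := isDP_of_mulDistLE hexp.2 fun D => (hA C' hC' hbody D).2
      rwa [show ε / 2 / 3 + ε / 2 / 3 + ε / 2 / 3 = ε / 2 by ring] at h
  have hloc := isPrivateSolver_localization hC hp hn hL hΔ hε hlip hsc hcomp hsolver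
  refine ⟨hloc, fun hB => ?_⟩
  have hnp : (1 : ℝ) ≤ p * n ^ 2 :=
    one_le_mul_of_one_le_of_one_le (by exact_mod_cast hp)
      (one_le_pow₀ (by exact_mod_cast (by omega : 1 ≤ n)))
  refine excessRiskLE_localization_of_le_expSampling hC hp hn hL hΔ hε
    (ε' := ε / 2 / 3) (by positivity) (Real.exp_pos _).le (by linarith)
    (hB.trans (le_mul_of_one_le_right (hε.le.trans hB) hnp)) hlip hsc hcomp hloc
    (fun C' hC' hbody => (hsolver C' hC' hbody).1)
    (fun C' hC' hbody D => Measure.le_intro fun S hS _ => ?_)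
  refine (((hA C' hC' hbody D).2 S hS).1).trans ?_
  have hexp : Real.exp (ε / 2 / 3) ≤ Real.exp (B / 6) := Real.exp_le_exp.2 (by linarith)
  rw [Measure.smul_apply, smul_eq_mul]
  gcongr

end PrivateERM

theorem mainTheorem4 (B : ℝ) (hB : 0 < B) :
    ∃ K : ℝ, 0 < K ∧
      ∀ (p n : ℕ), 1 ≤ p → 2 ≤ n →
      ∀ (X : Type u) (ℓ : EuclideanSpace ℝ (Fin p) → X → ℝ) (C : Set (EuclideanSpace ℝ (Fin p)))
        (L Δ ε : ℝ), 0 < L → 0 < Δ → 0 < ε →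
        Convex ℝ C → IsClosed C → Bornology.IsBounded C → (interior C).Nonempty →
        (∀ d, StrongConvexOn C Δ fun θ => ℓ θ d) → IsLipschitzLoss ℓ L C →
        -- the first step: the noise norm is Gamma distributed; the radius of the ball `C₀`
        (noise p (n * Δ * (ε / 2) / (2 * L))).map (fun b => ‖b‖) =
            gammaMeasure p (n * Δ * ε / (4 * L)) ∧
        (∀ θ₀, locSet n L Δ ε C θ₀ =
          C ∩ Metric.closedBall θ₀ (12 * (L * p * Real.log n / (Δ * ε * n)))) ∧
        -- localization with exponential sampling: privacy
        IsPrivateSolver (localization (expSampling p n) Δ) ℓ L ε C ∧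
        -- localization with exponential sampling: utility
        (ε ≤ B * (p * n ^ 2) → ∀ D : Fin n → X,
          ExcessRiskLE ℓ C D
            (localization (expSampling p n) Δ X ℓ L ε C D)
            (K * (p ^ 2 * L ^ 2 / (n * Δ * ε ^ 2) * Real.log n))) ∧
        -- localization with a sampler that is multiplicatively close to exponential sampling
        (∀ A : LipAlgorithm.{u} p n, IsComposable A ℓ L Δ ε C →
          (∀ C' ⊆ C, IsBody C' → ∀ D,
            IsProbabilityMeasure (A X ℓ L (ε / 2) C' D) ∧
            MulDistLE (ε / 2 / 3) (A X ℓ L (ε / 2) C' D)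
              (expSampling p n X ℓ L (ε / 2 / 3) C' D)) →
          IsPrivateSolver (localization A Δ) ℓ L ε C ∧
          (ε ≤ B → ∀ D : Fin n → X,
            ExcessRiskLE ℓ C D (localization A Δ X ℓ L ε C D)
              (K * (p ^ 2 * L ^ 2 / (n * Δ * ε ^ 2) * Real.log n)))) ∧
        -- localization with a generic algorithm: privacy
        (∀ A : LipAlgorithm.{u} p n, IsComposable A ℓ L Δ ε C →
          (∀ C' ⊆ C, IsBody C' → IsPrivateSolver A ℓ L (ε / 2) C') →
          IsPrivateSolver (localization A Δ) ℓ L ε C) ∧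
        -- localization with a generic algorithm: utility
        (∀ (A : LipAlgorithm.{u} p n) (F : ℕ → ℕ → ℝ → ℝ → ℝ → ℝ),
          IsComposable A ℓ L Δ ε C →
          MonotoneOn (F p n (ε / 2) L) (Set.Ici 0) →
          (∀ (X' : Type u) (ℓ' : EuclideanSpace ℝ (Fin p) → X' → ℝ), ∀ C' ⊆ C,
            IsBody C' → (∀ d, ConvexOn ℝ C' fun θ => ℓ' θ d) →
            IsLipschitzLoss ℓ' L C' →
            IsPrivateSolver A ℓ' L (ε / 2) C' ∧
            ∀ D : Fin n → X', ExcessRiskLE ℓ' C' D (A X' ℓ' L (ε / 2) C' D)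
              (F p n (ε / 2) L (Metric.diam C'))) →
          ε ≤ B → ∀ D : Fin n → X,
            ExcessRiskLE ℓ C D (localization A Δ X ℓ L ε C D)
              (K * F p n (ε / 2) L (24 * (L * p * Real.log n / (Δ * ε * n))))) := by
  refine ⟨576 * Real.exp (B / 6) + 48 * Real.exp 1 * B +
    (1 + 4 * Real.exp 1 * (1 + Real.exp (B / 2))), by positivity, ?_⟩
  intro p n hp hn X ℓ C L Δ ε hL hΔ hε hconv hclosed hbdd hint hsc hlip
  have hC : IsBody C := ⟨hconv, Metric.isCompact_of_isClosed_isBounded hclosed hbdd, hint⟩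
  have hn' : (0 : ℝ) < n := by positivity
  have hlog : 0 < Real.log n := Real.log_pos (by exact_mod_cast hn)
  have hmono : ∀ {D : Fin n → X} {μ : Measure (EuclideanSpace ℝ (Fin p))} {k K T : ℝ},
      k ≤ K → 0 ≤ T → ExcessRiskLE ℓ C D μ (k * T) → ExcessRiskLE ℓ C D μ (K * T) :=
    fun hk hT h => ⟨h.1, h.2.trans (mul_le_mul_of_nonneg_right hk hT)⟩
  have hK : 576 * Real.exp (B / 6) + 48 * Real.exp 1 * B ≤
      576 * Real.exp (B / 6) + 48 * Real.exp 1 * B +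
        (1 + 4 * Real.exp 1 * (1 + Real.exp (B / 2))) :=
    le_add_of_nonneg_right (by positivity)
  have hcompE : IsComposable (expSampling p n) ℓ L Δ ε C := isComposable_expSampling hC hlip
  have hsolE : ∀ C' ⊆ C, IsBody C' → IsPrivateSolver (expSampling p n) ℓ L (ε / 2) C' :=
    fun C' hC' hbody => isPrivateSolver_expSampling hbody hL (by positivity) (hlip.mono hC')
  have hlocE := isPrivateSolver_localization hC hp hn hL hΔ hε hlip hsc hcompE hsolE
  refine ⟨?_, locSet_eq n L C, hlocE, fun hB' D => ?_, fun A hcomp hA => ?_, fun A hcomp hA => ?_,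
    fun A F hcomp hF hA hB' D => ?_⟩
  · rw [map_norm_noise hp (by positivity)]
    congr 1
    field_simp
    norm_num
  · refine hmono ?_ (by positivity) (excessRiskLE_localization_of_le_expSampling hC hp hn hL hΔ hε
      (ε' := ε / 2) (c := 1) (by positivity) zero_le_one (by linarith) hB' hlip hsc hcompE hlocE
      (fun C' hC' hbody => (hsolE C' hC' hbody).1)
      (fun C' _ _ D => by rw [ENNReal.ofReal_one, one_smul]) D)
    have : 1 ≤ Real.exp (B / 6) := Real.one_le_exp (by positivity)
    linarith
  · obtain ⟨h1, h2⟩ := localization_of_mulDistLE (B := B) hC hp hn hL hΔ hε hlip hsc hcomp hA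
    exact ⟨h1, fun hB' D => hmono hK (by positivity) (h2 hB' D)⟩
  · exact isPrivateSolver_localization hC hp hn hL hΔ hε hlip hsc hcomp hA
  -- Enlarging the constant to `K` requires the value of `F` to be nonnegative. This follows from
  -- the risk hypothesis on a localized set around any point of `C` (here the projection of `0`) and
  -- monotonicity.
  · have hbody := isBody_locSet (n := n) hC hp hn hL hΔ hε (proj_mem hC.2.1
      (hC.2.2.mono interior_subset) 0)
    refine hmono (le_add_of_nonneg_left (by positivity)) ?_
      (excessRiskLE_localization_of_generic hC hp hn hL hΔ hε hB' hlip hsc hcomp hF hA D)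
    refine (mul_diam_le_of_isPrivateSolver hbody (by omega) hL.le
      (fun X' ℓ' => hA X' ℓ' _ (locSet_subset _) hbody)).1.trans ?_
    refine hF Metric.diam_nonneg (show (0 : ℝ) ≤ _ by positivity) ?_
    rw [locSet_eq]
    refine (diam_inter_closedBall_le C _ (radius_pos hp hn hL hΔ hε).le).trans_eq ?_
    ring
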